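/- A \emph{path linkage} $P$ with $k$ edges is a path graph with vertices $v_0,\dots,v_k$ and edges $\{v_{i-1},v_i\}$ ($1\le i\le k$), together with a length $l_i\ge 0$ for each edge $\{v_{i-1},v_i\}$. Its terminal vertices are $s=v_0$ and $t=v_k$. Let $C(P)$ be the space of all maps $p:\{v_0,\dots,v_k\}\to\mathbb R^2$ with $|p(v_{i-1})-p(v_i)|=l_i$ for all $i$, topologised as a subspace of $\mathbb R^{2(k+1)}$, and let $M(P)$ be the orbit space (with the quotient topology) of the action of the group of orientation preserving isometries of $\mathbb R^2$ on $C(P)$ by composition. Write $[P]=\{|p(s)-p(t)| : p\in M(P)\}\subseteq\mathbb R$, let $\theta:M(P)\to[P]$ be the map $\theta(p)=|p(s)-p(t)|$, and let $\nabla(P)=\{x\in[P] : \theta^{-1}(x)\text{ is connected}\}$. \textbf{Theorem.} Let $P$ be a path linkage with $k\ge 2$ edges, all of nonzero length, and let $p,q\in M(P)$ be arbitrary. Let $\alpha:[0,1]\to[P]$ be continuous, and suppose that for some $\epsilon>0$ we have $\alpha(x)=\theta(p)$ for all $x\in[0,\epsilon]$, and that for some $\delta>0$ we have $\alpha(x)=\theta(q)$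 for all $x\in[1-\delta,1]$. If $\operatorname{im}(\alpha)\cap\nabla(P)$ is nonempty, then there exists a continuous map $\tilde\alpha:[0,1]\to M(P)$ such that $\tilde\alpha(0)=p$, $\tilde\alpha(1)=q$ and $\theta\circ\tilde\alpha=\alpha$. -/

import Mathlib

open scoped NNReal

/-- The Euclidean plane. -/
abbrev Plane : Type := EuclideanSpace ℝ (Fin 2)

/-- The group of orientation preserving isometries of the plane: those affine isometries whose
linear part has positive determinant. -/
def orientationPreservingIsometries : Subgroup (Plane ≃ᵃⁱ[ℝ] Plane) where
  carrier := {g | 0 < LinearMap.det (g.linearIsometryEquiv.toLinearEquiv : Plane →ₗ[ℝ] Plane)}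
  one_mem' := by
    change 0 < LinearMap.det (LinearMap.id : Plane →ₗ[ℝ] Plane)
    simp
  mul_mem' := by
    intro a b ha hb
    change 0 < LinearMap.det
      ((a.linearIsometryEquiv.toLinearEquiv : Plane →ₗ[ℝ] Plane) ∘ₗ
        (b.linearIsometryEquiv.toLinearEquiv : Plane →ₗ[ℝ] Plane))
    rw [LinearMap.det_comp]
    exact mul_pos ha hb
  inv_mem' := by
    intro a ha
    change 0 < LinearMap.det
      (a.linearIsometryEquiv.toLinearEquiv.symm : Plane →ₗ[ℝ] Plane)
    have h := LinearEquiv.det_symm_mul_det a.linearIsometryEquiv.toLinearEquiv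
    by_contra hn
    have h1 : 0 < LinearMap.det
      (a.linearIsometryEquiv.toLinearEquiv : Plane →ₗ[ℝ] Plane) := ha
    nlinarith

/-- A linkage on the vertex set `V`: a graph together with a nonnegative length for every edge.
(Parallel edges do not occur in path graphs, so simple graphs suffice here.) -/
structure Linkage (V : Type*) where
  /-- the underlying graph -/
  graph : SimpleGraph V
  /-- the length function -/
  len : graph.edgeSet → ℝ≥0

namespace Linkage

variable {V : Type*}

/-- The space `C(L)` of planar configurations of `L`, with the topology of a subspace of the
product of copies of the plane indexed by the vertices. -/
def Config (L : Linkage V) : Type _ :=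
  {p : V → Plane // ∀ (u v : V) (h : L.graph.Adj u v),
    dist (p u) (p v) = L.len ⟨s(u, v), L.graph.mem_edgeSet.mpr h⟩}

instance (L : Linkage V) : TopologicalSpace L.Config :=
  inferInstanceAs (TopologicalSpace (Subtype _))

/-- The action of the orientation preserving isometries on `C(L)` by composition. -/
noncomputable instance (L : Linkage V) : MulAction orientationPreservingIsometries L.Config where
  smul g p := ⟨fun v => g.1 (p.1 v), fun u v h => by
    rw [g.1.dist_map]
    exact p.2 u v h⟩
  one_smul _ := rfl
  mul_smul _ _ _ := rfl

/-- The moduli space `M(L)`: the orbit space of `C(L)`, with the quotient topology. -/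
abbrev Moduli (L : Linkage V) : Type _ :=
  Quotient (MulAction.orbitRel orientationPreservingIsometries L.Config)

/-- The function `p ↦ |p(s) - p(t)|` on `M(L)`. -/
noncomputable def endDist (L : Linkage V) (s t : V) : L.Moduli → ℝ :=
  Quotient.lift (fun p : L.Config => dist (p.1 s) (p.1 t)) (by
    rintro _ b ⟨g, rfl⟩
    exact g.1.dist_map (b.1 s) (b.1 t))

/-- The set `[L, s, t]` of all values of `|p(s) - p(t)|` as `p` ranges over `M(L)`. -/
def distSet (L : Linkage V) (s t : V) : Set ℝ :=
  Set.range (L.endDist s t)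

/-- The map `θ : M(L) → [L, s, t]`, `θ(p) = |p(s) - p(t)|`. -/
noncomputable def theta (L : Linkage V) (s t : V) : L.Moduli → L.distSet s t :=
  Set.rangeFactorization (L.endDist s t)

/-- The set `∇(L)` of those `x ∈ [L, s, t]` whose fibre `θ⁻¹(x)` is connected. -/
def nabla (L : Linkage V) (s t : V) : Set (L.distSet s t) :=
  {x | IsConnected (L.theta s t ⁻¹' {x})}

/-- `L` is a path linkage with `k` edges and terminal vertices `s` and `t`: its graph is
isomorphic to the standard path on `k + 1` vertices, with `s` and `t` as the two ends. -/
def IsPathLinkage (L : Linkage V) (k : ℕ) (s t : V) : Prop :=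
  ∃ φ : SimpleGraph.pathGraph (k + 1) ≃g L.graph, φ 0 = s ∧ φ (Fin.last k) = t

end Linkage

/-! Modulo orientation preserving isometries a configuration is its tuple `z` of edge directions in
`Circle`, up to a common rotation, and `θ` becomes `chainDist l z = ‖∑ l i * z i‖`. This is
symmetric in the edges, so they may be sorted by decreasing length, and one inducts by prepending
the longest edge (`ChainData.step`, `exists_chainData_of_antitone`).

Let the new edge have length `L`, the tail end distance `y ∈ [m, B]`, the whole chain end distance
`x`. Then `L`, `y`, `x` are the sides of a triangle, and for `y > 0` the tail and `x` determine the
new edge up to a sign (`attach`). To lift a path of `x`, choose a path of `y` with `max |L - x| m ≤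
y ≤ min (L + x) B`, lift it by induction and attach. Two ambiguities remain: the sign, which can
change where the triangle degenerates, and a reflection of the tail, which is harmless if `y` can
visit the good set `G` of the tail. For `x ≤ B - L` the degenerate value `y = L + x` is available;
for `x ≥ B - L` the value `y = B ∈ G` is. One ambiguity can thus always be removed, and lifts exist
up to the global reflection `z ↦ z⁻¹` (`step_lift_or`).

`stepSet` consists of the `x` at which the other ambiguity can be removed as well. If a path meets
it at an end, the fibre there absorbs the reflection. Otherwise its first meeting is a boundary
point of `stepSet`, where a single `y` is both degenerate and in `G`, so one visit settles both
ambiguities (`exists_degenerate_of_frequently`, `step_lift`). Outside the good set a rotation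
invariant function, odd under reflection, has no zero on the fibre (`step_sep`), so the fibre is
disconnected and `∇` lies in the good set (`not_mem_nabla`).

The pauses of `α` provide time to move inside the end fibres. They are also where a closed tail, `y
= 0`, is opened (`exists_joined_of_tail_closed`); this needs the new edge to be the longest. -/

/-! ### Lifting paths along a real function. -/

/-- `α` lifts along `f` over `[a, b]` to a path from `z` to `w`. -/
def LiftOn {X : Type*} [TopologicalSpace X] (f : X → ℝ) (α : ℝ → ℝ) (a b : ℝ) (z w : X) : Prop :=
  ∃ γ : ℝ → X, ContinuousOn γ (Set.Icc a b) ∧ γ a = z ∧ γ b = w ∧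
    ∀ t ∈ Set.Icc a b, f (γ t) = α t

namespace LiftOn

variable {X : Type*} [TopologicalSpace X] {f : X → ℝ} {α β : ℝ → ℝ} {a b c : ℝ} {z w v : X}

theorem trans (h₁ : LiftOn f α a b z w) (h₂ : LiftOn f α b c w v) (hab : a ≤ b) (hbc : b ≤ c) :
    LiftOn f α a c z v := by
  obtain ⟨γ, hγ, ha, hb, hf⟩ := h₁
  obtain ⟨η, hη, hb', hc, hg⟩ := h₂
  have e₁ : Set.EqOn (fun t => if t ≤ b then γ t else η t) γ (Set.Icc a b) := by
    intro t ht
    simp [ht.2]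
  have e₂ : Set.EqOn (fun t => if t ≤ b then γ t else η t) η (Set.Icc b c) := by
    intro t ht
    by_cases h : t ≤ b
    · have : t = b := le_antisymm h ht.1
      simp [this, hb, hb']
    · simp [h]
  refine ⟨fun t => if t ≤ b then γ t else η t, ?_, ?_, ?_, ?_⟩
  · rw [← Set.Icc_union_Icc_eq_Icc hab hbc]
    exact (hγ.congr e₁).union_of_isClosed (hη.congr e₂) isClosed_Icc isClosed_Icc
  · rw [← ha]
    exact e₁ (Set.left_mem_Icc.2 hab)
  · rw [← hc]
    exact e₂ (Set.right_mem_Icc.2 hbc)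
  · intro t ht
    rcases le_total t b with h | h
    · have := e₁ (x := t) ⟨ht.1, h⟩
      rw [this]
      exact hf t ⟨ht.1, h⟩
    · have := e₂ (x := t) ⟨h, ht.2⟩
      rw [this]
      exact hg t ⟨h, ht.2⟩

theorem joinedIn {x : ℝ} (h : LiftOn f (fun _ => x) 0 1 z w) : JoinedIn {v | f v = x} z w := by
  obtain ⟨γ, hγ, ha, hb, hf⟩ := h
  refine JoinedIn.ofLine hγ ha hb ?_
  rintro _ ⟨t, ht, rfl⟩
  exact hf t ht

theorem of_joinedIn {x : ℝ} (h : JoinedIn {v | f v = x} z w) (hab : a < b)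
    (hα : ∀ t ∈ Set.Icc a b, α t = x) : LiftOn f α a b z w := by
  have hba : b - a ≠ 0 := by linarith
  refine ⟨fun t => h.somePath.extend ((t - a) / (b - a)), ?_, ?_, ?_, ?_⟩
  · exact (h.somePath.extend.continuous.comp (by fun_prop)).continuousOn
  · simp
  · simp [div_self hba]
  · intro t ht
    have : (t - a) / (b - a) ∈ Set.Icc (0 : ℝ) 1 :=
      ⟨div_nonneg (by linarith [ht.1]) (by linarith), (div_le_one (by linarith)).2 (by linarith [ht.2])⟩
    change f (h.somePath.extend ((t - a) / (b - a))) = α t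
    rw [Path.extend_apply _ this, hα t ht]
    exact h.somePath_mem _

theorem map {Y : Type*} [TopologicalSpace Y] {g : Y → ℝ} {F : X → Y} (h : LiftOn f α a b z w)
    (hF : Continuous F) (hg : ∀ x, g (F x) = f x) : LiftOn g α a b (F z) (F w) := by
  obtain ⟨γ, hγ, ha, hb, hf⟩ := h
  exact ⟨fun t => F (γ t), hF.comp_continuousOn hγ, congrArg F ha, congrArg F hb,
    fun t ht => by rw [hg, hf t ht]⟩

end LiftOn

/-! ### Positive interpolating functions. -/

theorem exists_transition {p q A B : ℝ} (hpq : p < q) (hA : 0 < A) (hB : 0 < B) :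
    ∃ g : ℝ → ℝ, Continuous g ∧ (∀ t ≤ p, g t = A) ∧ (∀ t, q ≤ t → g t = B) ∧ ∀ t, 0 < g t := by
  have hqp : 0 < q - p := by linarith
  refine ⟨fun t => (1 - max 0 (min 1 ((t - p) / (q - p)))) * A +
    max 0 (min 1 ((t - p) / (q - p))) * B, by fun_prop, ?_, ?_, ?_⟩
  · intro t ht
    have : (t - p) / (q - p) ≤ 0 := div_nonpos_of_nonpos_of_nonneg (by linarith) hqp.le
    have h : max 0 (min 1 ((t - p) / (q - p))) = 0 :=
      max_eq_left ((min_le_right _ _).trans this)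
    simp [h]
  · intro t ht
    have : 1 ≤ (t - p) / (q - p) := (one_le_div hqp).2 (by linarith)
    have h : max 0 (min 1 ((t - p) / (q - p))) = 1 := by
      rw [min_eq_left this]
      simp
    simp [h]
  · intro t
    have h0 : 0 ≤ max 0 (min 1 ((t - p) / (q - p))) := le_max_left _ _
    have h1 : max 0 (min 1 ((t - p) / (q - p))) ≤ 1 := max_le zero_le_one (min_le_left _ _)
    rcases h0.eq_or_lt with h | h
    · simp only [← h]
      linarith
    · have : 0 ≤ (1 - max 0 (min 1 ((t - p) / (q - p)))) * A := mul_nonneg (by linarith) hA.le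
      have := mul_pos h hB
      change 0 < (1 - max 0 (min 1 ((t - p) / (q - p)))) * A +
        max 0 (min 1 ((t - p) / (q - p))) * B
      linarith

/-- The prescribed value at `t₀` serves to steer the tail distance through a good or degenerate
length at that time. -/
theorem exists_transition_through {p t₀ q A Y B : ℝ} (hp : p < t₀) (hq : t₀ < q) (hA : 0 < A)
    (hY : 0 < Y) (hB : 0 < B) :
    ∃ g : ℝ → ℝ, Continuous g ∧ (∀ t ≤ p, g t = A) ∧ (∀ t, q ≤ t → g t = B) ∧ (∀ t, 0 < g t) ∧
      g t₀ = Y := by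
  obtain ⟨g, hg, gA, gY, g0⟩ := exists_transition hp hA hY
  obtain ⟨k, hk, kY, kB, k0⟩ := exists_transition hq hY hB
  refine ⟨fun t => if t ≤ t₀ then g t else k t, ?_, ?_, ?_, ?_, ?_⟩
  · refine hg.if_le hk continuous_id continuous_const ?_
    rintro t rfl
    rw [gY t le_rfl, kY t le_rfl]
  · intro t ht
    simp [gA t ht, (ht.trans hp.le)]
  · intro t ht
    simp [kB t ht, not_le.2 (hq.trans_le ht)]
  · intro t
    by_cases h : t ≤ t₀
    · simp [h, g0]
    · simp [h, k0]
  · simp [gY]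

/-! ### Chains of edge directions. -/

/-- The vector from the start to the end of a chain of edges with lengths `l` and directions
`z`. -/
noncomputable def chainVec {n : ℕ} (l : Fin n → ℝ) (z : Fin n → Circle) : ℂ :=
  ∑ i, (l i : ℂ) * z i

/-- The distance between the ends of a chain. -/
noncomputable def chainDist {n : ℕ} (l : Fin n → ℝ) (z : Fin n → Circle) : ℝ := ‖chainVec l z‖

section Chain

variable {n : ℕ}

@[fun_prop]
theorem continuous_coe_circle : Continuous ((↑) : Circle → ℂ) := continuous_subtype_val

@[fun_prop]
theorem continuous_chainVec (l : Fin n → ℝ) : Continuous (chainVec l) := by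
  unfold chainVec
  fun_prop

theorem chainDist_nonneg (l : Fin n → ℝ) (z : Fin n → Circle) : 0 ≤ chainDist l z := norm_nonneg _

theorem chainVec_ne_zero {l : Fin n → ℝ} {z : Fin n → Circle} (h : 0 < chainDist l z) :
    chainVec l z ≠ 0 := norm_pos_iff.1 h

/-- Inversion on the circle is conjugation, so `z⁻¹` is the mirror image of the chain `z`. -/
theorem chainVec_inv (l : Fin n → ℝ) (z : Fin n → Circle) :
    chainVec l z⁻¹ = (starRingEnd ℂ) (chainVec l z) := by
  simp only [chainVec, map_sum, map_mul, Complex.conj_ofReal]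
  exact Finset.sum_congr rfl fun i _ => by rw [Pi.inv_apply, Circle.coe_inv_eq_conj]

@[simp]
theorem chainDist_inv (l : Fin n → ℝ) (z : Fin n → Circle) : chainDist l z⁻¹ = chainDist l z := by
  rw [chainDist, chainVec_inv, Complex.norm_conj, chainDist]

/-- Rotate all the edges of a chain by the same angle. -/
noncomputable def rotateAll (c : Circle) (z : Fin n → Circle) : Fin n → Circle := fun i => c * z i

theorem chainVec_rotateAll (l : Fin n → ℝ) (c : Circle) (z : Fin n → Circle) :
    chainVec l (rotateAll c z) = c * chainVec l z := by
  simp only [chainVec, rotateAll, Finset.mul_sum, Circle.coe_mul]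
  exact Finset.sum_congr rfl fun i _ => by ring

theorem chainVec_cons (l : Fin (n + 1) → ℝ) (u : Circle) (ω : Fin n → Circle) :
    chainVec l (Fin.cons u ω : Fin (n + 1) → Circle) = l 0 * u + chainVec (Fin.tail l) ω := by
  simp [chainVec, Fin.sum_univ_succ, Fin.tail]

theorem cons_inv_circle (u : Circle) (ω : Fin n → Circle) :
    (Fin.cons u ω : Fin (n + 1) → Circle)⁻¹ = (Fin.cons u⁻¹ ω⁻¹ : Fin (n + 1) → Circle) := by
  funext i
  refine Fin.cases ?_ (fun j => ?_) i <;> simp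

theorem JoinedIn.chain_inv {l : Fin n → ℝ} {x : ℝ} {z w : Fin n → Circle}
    (h : JoinedIn {v | chainDist l v = x} z w) : JoinedIn {v | chainDist l v = x} z⁻¹ w⁻¹ := by
  refine (h.map continuous_inv).mono ?_
  rintro _ ⟨v, hv, rfl⟩
  simpa using hv

theorem LiftOn.chain_inv {l : Fin n → ℝ} {α : ℝ → ℝ} {a b : ℝ} {z w : Fin n → Circle}
    (h : LiftOn (chainDist l) α a b z w) : LiftOn (chainDist l) α a b z⁻¹ w⁻¹ :=
  h.map continuous_inv (chainDist_inv l)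

/-- The direction of a nonzero complex number. -/
noncomputable def circleDir (w : ℂ) : Circle :=
  open Classical in
  if h : w = 0 then 1 else ⟨w / ‖w‖, mem_sphere_zero_iff_norm.2 (by simp [h])⟩

theorem coe_circleDir {w : ℂ} (h : w ≠ 0) : (circleDir w : ℂ) = w / ‖w‖ := by
  simp [circleDir, h]

theorem norm_mul_circleDir (w : ℂ) : (‖w‖ : ℂ) * circleDir w = w := by
  by_cases h : w = 0
  · simp [h]
  · rw [coe_circleDir h]
    have : (‖w‖ : ℂ) ≠ 0 := by simpa using h
    field_simp

theorem circleDir_norm_mul {r : ℝ} (hr : 0 < r) (u : Circle) : circleDir (r * u) = u := by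
  have h : (r : ℂ) ≠ 0 := by exact_mod_cast hr.ne'
  ext
  rw [coe_circleDir (mul_ne_zero h u.coe_ne_zero), norm_mul, Circle.norm_coe, Complex.norm_real,
    Real.norm_of_nonneg hr.le, mul_one]
  field_simp

theorem continuousOn_circleDir : ContinuousOn circleDir {0}ᶜ := by
  have hi : Topology.IsInducing ((↑) : Circle → ℂ) := Topology.IsInducing.subtypeVal
  refine hi.continuousOn_iff.2 ?_
  refine ContinuousOn.congr (f := fun w : ℂ => w / ‖w‖) ?_ (fun w hw => coe_circleDir hw)
  refine continuousOn_id.div (by fun_prop) ?_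
  intro w hw
  simpa using hw

theorem circleDir_conj (w : ℂ) : circleDir ((starRingEnd ℂ) w) = (circleDir w)⁻¹ := by
  by_cases h : w = 0
  -- The default direction `1` at the origin is its own inverse.
  · simp [h, circleDir]
  · ext
    rw [coe_circleDir (by simpa using h), Circle.coe_inv_eq_conj, coe_circleDir h]
    simp

/-! ### Attaching an edge by solving a triangle. -/

/-- The cosine of the exterior angle between sides `L` and `y` of a triangle with third side
`x`. -/
noncomputable def turnCos (L x y : ℝ) : ℝ := (x ^ 2 - L ^ 2 - y ^ 2) / (2 * L * y)

theorem turnCos_mem {L x y : ℝ} (hL : 0 < L) (hy : 0 < y) (hx : 0 ≤ x) (h₁ : |L - x| ≤ y)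
    (h₂ : y ≤ L + x) : -1 ≤ turnCos L x y ∧ turnCos L x y ≤ 1 := by
  rw [abs_le] at h₁
  have : 0 < 2 * L * y := by positivity
  unfold turnCos
  constructor
  · rw [le_div_iff₀ this]
    nlinarith
  · rw [div_le_one this]
    nlinarith

/-- The law of cosines, with `θ` the exterior angle. -/
theorem norm_turn {L y : ℝ} (u : Circle) (θ : ℝ) :
    ‖(L : ℂ) * ((u * Circle.exp θ : Circle) : ℂ) + y * u‖ ^ 2 =
      L ^ 2 + y ^ 2 + 2 * L * y * Real.cos θ := by
  have : (L : ℂ) * ((u * Circle.exp θ : Circle) : ℂ) + y * u = u * (L * Circle.exp θ + y) := by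
    push_cast
    ring
  rw [this, norm_mul, Circle.norm_coe, one_mul, ← Complex.normSq_eq_norm_sq, Complex.normSq_apply,
    Circle.coe_exp, Complex.exp_mul_I, ← Complex.ofReal_cos, ← Complex.ofReal_sin]
  simp only [Complex.add_re, Complex.add_im, Complex.mul_re, Complex.mul_im, Complex.ofReal_re,
    Complex.ofReal_im, Complex.I_re, Complex.I_im]
  linear_combination L ^ 2 * Real.sin_sq_add_cos_sq θ

theorem norm_turn_of_cos {L x y θ : ℝ} (u : Circle) (hx : 0 ≤ x)
    (h : 2 * L * y * Real.cos θ = x ^ 2 - L ^ 2 - y ^ 2) :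
    ‖(L : ℂ) * ((u * Circle.exp θ : Circle) : ℂ) + y * u‖ = x := by
  have h2 := norm_turn (L := L) (y := y) u θ
  rw [h] at h2
  refine (sq_eq_sq₀ (norm_nonneg _) hx).1 ?_
  linarith

theorem cos_sign_mul {s : ℝ} (hs : s = 1 ∨ s = -1) (θ : ℝ) : Real.cos (s * θ) = Real.cos θ := by
  rcases hs with rfl | rfl <;> simp

/-- Prepend to `ω` an edge of length `l 0` making the end distance equal to `x`; the sign `s`
chooses between the two possibilities. -/
noncomputable def attach (l : Fin (n + 1) → ℝ) (s x : ℝ) (ω : Fin n → Circle) :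
    Fin (n + 1) → Circle :=
  Fin.cons (circleDir (chainVec (Fin.tail l) ω) *
    Circle.exp (s * Real.arccos (turnCos (l 0) x (chainDist (Fin.tail l) ω)))) ω

/-- The global reflection is the composite of the sign change and the reflection of the tail. -/
theorem attach_inv (l : Fin (n + 1) → ℝ) (s x : ℝ) (ω : Fin n → Circle) :
    (attach l s x ω)⁻¹ = attach l (-s) x ω⁻¹ := by
  rw [attach, cons_inv_circle, attach, chainVec_inv, circleDir_conj, chainDist_inv, neg_mul,
    Circle.exp_neg, mul_inv]

theorem chainDist_attach {l : Fin (n + 1) → ℝ} {s x : ℝ} {ω : Fin n → Circle} (hl : 0 < l 0)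
    (hs : s = 1 ∨ s = -1) (hx : 0 ≤ x) (hω : 0 < chainDist (Fin.tail l) ω)
    (h₁ : |l 0 - x| ≤ chainDist (Fin.tail l) ω) (h₂ : chainDist (Fin.tail l) ω ≤ l 0 + x) :
    chainDist l (attach l s x ω) = x := by
  obtain ⟨c₁, c₂⟩ := turnCos_mem hl hω hx h₁ h₂
  rw [chainDist, attach, chainVec_cons]
  nth_rewrite 2 [← norm_mul_circleDir (chainVec (Fin.tail l) ω)]
  refine norm_turn_of_cos (y := chainDist (Fin.tail l) ω) _ hx ?_
  rw [cos_sign_mul hs, Real.cos_arccos c₁ c₂, turnCos]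
  have : 2 * l 0 * chainDist (Fin.tail l) ω ≠ 0 := by positivity
  exact mul_div_cancel₀ _ this

theorem triangle_tail {l : Fin (n + 1) → ℝ} (hl : 0 < l 0) (z : Fin (n + 1) → Circle) :
    |l 0 - chainDist l z| ≤ chainDist (Fin.tail l) (Fin.tail z) ∧
      chainDist (Fin.tail l) (Fin.tail z) ≤ l 0 + chainDist l z := by
  have e : chainVec l z = l 0 * z 0 + chainVec (Fin.tail l) (Fin.tail z) := by
    rw [← chainVec_cons, Fin.cons_self_tail]
  have e0 : ‖(l 0 : ℂ) * z 0‖ = l 0 := by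
    rw [norm_mul, Circle.norm_coe, Complex.norm_real, Real.norm_of_nonneg hl.le, mul_one]
  have h1 := norm_add_le ((l 0 : ℂ) * z 0) (chainVec (Fin.tail l) (Fin.tail z))
  have h2 := norm_sub_le (chainVec l z) ((l 0 : ℂ) * z 0)
  have h3 := norm_sub_le (chainVec l z) (chainVec (Fin.tail l) (Fin.tail z))
  rw [← e] at h1
  have e1 : chainVec l z - (l 0 : ℂ) * z 0 = chainVec (Fin.tail l) (Fin.tail z) := by
    rw [e]
    ring
  have e2 : chainVec l z - chainVec (Fin.tail l) (Fin.tail z) = (l 0 : ℂ) * z 0 := by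
    rw [e]
    ring
  rw [e1] at h2
  rw [e2] at h3
  rw [e0] at h1 h2 h3
  unfold chainDist
  refine ⟨abs_le.2 ⟨?_, ?_⟩, ?_⟩ <;> linarith

/-- The angle `θ` from the tail vector to the first edge satisfies `|θ| ≤ π`, so `arccos` recovers
`|θ|` from the three sides and only the sign of `θ` is left to choose. -/
theorem exists_eq_attach {l : Fin (n + 1) → ℝ} (hl : 0 < l 0) (z : Fin (n + 1) → Circle)
    (hz : 0 < chainDist (Fin.tail l) (Fin.tail z)) :
    ∃ s : ℝ, (s = 1 ∨ s = -1) ∧ z = attach l s (chainDist l z) (Fin.tail z) := by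
  set W := chainVec (Fin.tail l) (Fin.tail z) with hW
  set y := chainDist (Fin.tail l) (Fin.tail z) with hy
  set v : Circle := (circleDir W)⁻¹ * z 0 with hv
  set θ := Complex.arg v with hθ
  have hz0 : z 0 = circleDir W * Circle.exp θ := by
    rw [hθ, Circle.exp_arg, hv]
    simp
  have key : chainDist l z ^ 2 = l 0 ^ 2 + y ^ 2 + 2 * l 0 * y * Real.cos θ := by
    rw [← norm_turn (circleDir W) θ, ← hz0, hy, chainDist, chainDist, ← hW, norm_mul_circleDir,
      hW, ← chainVec_cons, Fin.cons_self_tail]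
  have hc : turnCos (l 0) (chainDist l z) y = Real.cos |θ| := by
    rw [Real.cos_abs, turnCos, key]
    field_simp
    ring
  have hac : Real.arccos (turnCos (l 0) (chainDist l z) y) = |θ| := by
    rw [hc, Real.arccos_cos (abs_nonneg _) (Complex.abs_arg_le_pi _)]
  have hmain : ∀ s : ℝ, s * |θ| = θ → z = attach l s (chainDist l z) (Fin.tail z) := by
    intro s hs
    rw [attach, ← hy, hac, hs, ← hW, ← hz0, Fin.cons_self_tail]
  rcases le_total 0 θ with h | h
  · exact ⟨1, Or.inl rfl, hmain 1 (by rw [abs_of_nonneg h, one_mul])⟩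
  · exact ⟨-1, Or.inr rfl, hmain (-1) (by rw [abs_of_nonpos h]; ring)⟩

/-- In a flat triangle the turning angle is `0` or `π`, and both are unchanged by a sign modulo
`2π`. -/
theorem attach_neg_of_degenerate {l : Fin (n + 1) → ℝ} {s x : ℝ} {ω : Fin n → Circle}
    (hl : 0 < l 0) (hs : s = 1 ∨ s = -1) (hω : 0 < chainDist (Fin.tail l) ω)
    (h : chainDist (Fin.tail l) ω = |l 0 - x| ∨ chainDist (Fin.tail l) ω = l 0 + x) :
    attach l (-s) x ω = attach l s x ω := by
  set y := chainDist (Fin.tail l) ω with hy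
  have hc : turnCos (l 0) x y = 1 ∨ turnCos (l 0) x y = -1 := by
    have h2 : 2 * l 0 * y ≠ 0 := by positivity
    unfold turnCos
    rw [div_eq_iff h2, div_eq_iff h2]
    rcases h with h | h
    · rcases abs_choice (l 0 - x) with h' | h' <;> rw [h'] at h
      · right
        have : x = l 0 - y := by linarith
        rw [this]
        ring
      · left
        have : x = l 0 + y := by linarith
        rw [this]
        ring
    · right
      have : x = y - l 0 := by linarith
      rw [this]
      ring
  have he : Circle.exp (-Real.pi) = Circle.exp Real.pi := by
    ext
    simp [Circle.coe_exp]
  unfold attach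
  rw [← hy]
  rcases hc with hc | hc <;> rw [hc]
  · simp
  · rw [Real.arccos_neg_one]
    rcases hs with rfl | rfl <;> simp [he]

/-- Positivity of `y` keeps the tail vector away from the origin, the only place where its direction
can fail to be continuous. -/
theorem LiftOn.attach {l : Fin (n + 1) → ℝ} {s a b : ℝ} {α y : ℝ → ℝ} {ω ω' : Fin n → Circle}
    (hl : 0 < l 0) (hs : s = 1 ∨ s = -1) (hα : Continuous α) (hα0 : ∀ t, 0 ≤ α t)
    (hy : Continuous y) (hy0 : ∀ t, 0 < y t) (h₁ : ∀ t, |l 0 - α t| ≤ y t)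
    (h₂ : ∀ t, y t ≤ l 0 + α t) (h : LiftOn (chainDist (Fin.tail l)) y a b ω ω') :
    LiftOn (chainDist l) α a b (attach l s (α a) ω) (attach l s (α b) ω') := by
  obtain ⟨γ, hγ, ha, hb, hf⟩ := h
  refine ⟨fun t => _root_.attach l s (α t) (γ t), ?_, congrArg _ ha, congrArg _ hb, ?_⟩
  · unfold _root_.attach
    refine ContinuousOn.finCons ?_ hγ
    refine ContinuousOn.mul ?_ ?_
    · refine continuousOn_circleDir.comp ((continuous_chainVec _).comp_continuousOn hγ) ?_
      intro t ht
      exact chainVec_ne_zero (by rw [hf t ht]; exact hy0 t)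
    · refine ContinuousOn.congr (f := fun t =>
        Circle.exp (s * Real.arccos (turnCos (l 0) (α t) (y t)))) ?_
        (fun t ht => by simp only [hf t ht])
      refine Continuous.continuousOn ?_
      refine Circle.exp.continuous.comp (continuous_const.mul (Real.continuous_arccos.comp ?_))
      unfold turnCos
      refine Continuous.div (by fun_prop) (by fun_prop) ?_
      intro t
      have := hy0 t
      positivity
  · intro t ht
    have e := hf t ht
    refine chainDist_attach hl hs (hα0 t) ?_ ?_ ?_ <;> rw [e]
    exacts [hy0 t, h₁ t, h₂ t]

/-- The sign is switched at `t₀`, where the two attachments coincide. -/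
theorem LiftOn.attach_flip {l : Fin (n + 1) → ℝ} {s s' a b t₀ : ℝ} {α y : ℝ → ℝ}
    {ω ω' : Fin n → Circle}
    (hl : 0 < l 0) (hs : s = 1 ∨ s = -1) (hs' : s' = 1 ∨ s' = -1) (ht₀ : t₀ ∈ Set.Icc a b)
    (hα : Continuous α) (hα0 : ∀ t, 0 ≤ α t)
    (hy : Continuous y) (hy0 : ∀ t, 0 < y t) (h₁ : ∀ t, |l 0 - α t| ≤ y t)
    (h₂ : ∀ t, y t ≤ l 0 + α t) (hdeg : y t₀ = |l 0 - α t₀| ∨ y t₀ = l 0 + α t₀)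
    (h : LiftOn (chainDist (Fin.tail l)) y a b ω ω') :
    LiftOn (chainDist l) α a b (_root_.attach l s (α a) ω) (_root_.attach l s' (α b) ω') := by
  obtain ⟨γ, hγ, ha, hb, hf⟩ := h
  have A : LiftOn (chainDist (Fin.tail l)) y a t₀ ω (γ t₀) :=
    ⟨γ, hγ.mono (Set.Icc_subset_Icc_right ht₀.2), ha, rfl,
      fun t ht => hf t ⟨ht.1, ht.2.trans ht₀.2⟩⟩
  have B : LiftOn (chainDist (Fin.tail l)) y t₀ b (γ t₀) ω' :=
    ⟨γ, hγ.mono (Set.Icc_subset_Icc_left ht₀.1), rfl, hb,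
      fun t ht => hf t ⟨ht₀.1.trans ht.1, ht.2⟩⟩
  have A' := A.attach hl hs hα hα0 hy hy0 h₁ h₂
  have B' := B.attach hl hs' hα hα0 hy hy0 h₁ h₂
  have e : _root_.attach l s (α t₀) (γ t₀) = _root_.attach l s' (α t₀) (γ t₀) := by
    have hd := hf t₀ ht₀
    have := attach_neg_of_degenerate (x := α t₀) (ω := γ t₀) hl hs (by rw [hd]; exact hy0 _)
      (by rw [hd]; exact hdeg)
    rcases hs with rfl | rfl <;> rcases hs' with rfl | rfl <;> simp_all
  rw [e] at A'
  exact A'.trans B' ht₀.1 ht₀.2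

end Chain

/-! ### The inductive invariant and its base case. -/

/-- A continuous function which is constant on `[a, a']` and on `[b', b]`. -/
structure IsPaused (α : ℝ → ℝ) (a a' b' b : ℝ) : Prop where
  cont : Continuous α
  left_lt : a < a'
  mid_le : a' ≤ b'
  right_lt : b' < b
  left : ∀ t ∈ Set.Icc a a', α t = α a
  right : ∀ t ∈ Set.Icc b' b, α t = α b

/-- The inductive description of the end distance map of a chain of edges of lengths `l`: its range
is `[m, M]`, and `G` is the set of values with connected fibre. -/
structure ChainData {n : ℕ} (l : Fin (n + 1) → ℝ) (m M : ℝ) (G : Set ℝ) : Prop where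
  nonneg : 0 ≤ m
  pos : 0 < M
  le : m ≤ M
  range : ∀ z, chainDist l z ∈ Set.Icc m M
  surj : ∀ x ∈ Set.Icc m M, ∃ z, chainDist l z = x
  closed : IsClosed G
  subset : G ⊆ Set.Icc m M
  top_mem : M ∈ G
  bot_mem : 0 < m → m ∈ G
  near_zero : 0 ∈ G → (∃ η > 0, ∀ x, 0 ≤ x → x < η → x ≤ M → x ∈ G) ∨ M = 2 * l 0
  sep : ∀ J : Set ℝ, J.OrdConnected → J ⊆ Set.Icc m M \ G →
    ∃ g : (Fin (n + 1) → Circle) → ℝ, Continuous g ∧ (∀ z, g z⁻¹ = -g z) ∧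
      (∀ c z, g (rotateAll c z) = g z) ∧ ∀ z, chainDist l z ∈ J → g z ≠ 0
  lift_or : ∀ {α a a' b' b}, IsPaused α a a' b' b → (∀ t, α t ∈ Set.Icc m M) →
    ∀ {z w}, chainDist l z = α a → chainDist l w = α b →
      LiftOn (chainDist l) α a b z w ∨ LiftOn (chainDist l) α a b z w⁻¹
  lift : ∀ {α a a' b' b}, IsPaused α a a' b' b → (∀ t, α t ∈ Set.Icc m M) →
    ∀ {z w}, chainDist l z = α a → chainDist l w = α b → (∃ t ∈ Set.Icc a b, α t ∈ G) →
      LiftOn (chainDist l) α a b z w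

/-- The only fibre is the whole circle, which is path connected, so every lift can be made inside
it. -/
theorem chainData_single (l : Fin 1 → ℝ) (hl : 0 < l 0) : ChainData l (l 0) (l 0) {l 0} := by
  have hd : ∀ z, chainDist l z = l 0 := by
    intro z
    rw [chainDist, chainVec, Fin.sum_univ_one, norm_mul, Circle.norm_coe, Complex.norm_real,
      Real.norm_of_nonneg hl.le, mul_one]
  have hj : ∀ {α : ℝ → ℝ} {a a' b' b : ℝ}, IsPaused α a a' b' b →
      (∀ t, α t ∈ Set.Icc (l 0) (l 0)) → ∀ z w, LiftOn (chainDist l) α a b z w := by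
    intro α a a' b' b h hα z w
    refine LiftOn.of_joinedIn (x := l 0) ?_ ((h.left_lt.trans_le h.mid_le).trans h.right_lt)
      (fun t _ => le_antisymm (hα t).2 (hα t).1)
    have : {v | chainDist l v = l 0} = Set.univ := Set.eq_univ_of_forall hd
    rw [this, joinedIn_univ]
    exact PathConnectedSpace.joined z w
  refine ⟨hl.le, hl, le_rfl, fun z => by simp [hd], ?_, isClosed_singleton, by simp, rfl,
    fun _ => rfl, ?_, ?_, fun h hα z w _ _ => Or.inl (hj h hα z w),
    fun h hα z w _ _ _ => hj h hα z w⟩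
  · intro x hx
    exact ⟨1, by rw [hd]; exact le_antisymm hx.1 hx.2⟩
  · intro h
    exact absurd h hl.ne
  · intro J _ hJ
    refine ⟨fun _ => 0, continuous_const, by simp, by simp, fun z hz => ?_⟩
    have := (hJ hz).2
    simp [hd] at this

/-! ### Inductive step: choosing the tail distance. -/

section Step

variable {n : ℕ} {l : Fin (n + 2) → ℝ} {m B : ℝ} {G : Set ℝ}

/-- The least end distance after prepending an edge of length `L`. -/
noncomputable def stepLo (L m B : ℝ) : ℝ := max 0 (max (L - B) (m - L))

/-- The set of end distances with connected fibre after prepending an edge of length `L`. -/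
def stepSet (L m B : ℝ) (G : Set ℝ) : Set ℝ :=
  {x | x ∈ Set.Icc (stepLo L m B) (L + B) ∧
    ((x ≤ B - L ∧ ∃ y ∈ G, |L - x| ≤ y ∧ y ≤ L + x) ∨ (B - L ≤ x ∧ m ≤ |L - x|))}

theorem mem_stepIcc {L m B x : ℝ} : x ∈ Set.Icc (stepLo L m B) (L + B) ↔
    0 ≤ x ∧ L - B ≤ x ∧ m - L ≤ x ∧ x ≤ L + B := by
  simp [stepLo, and_assoc]

theorem abs_sub_le_of_mem {L m B x : ℝ} (hx : x ∈ Set.Icc (stepLo L m B) (L + B)) :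
    |L - x| ≤ B := by
  obtain ⟨_, h₂, _, h₄⟩ := mem_stepIcc.1 hx
  exact abs_le.2 ⟨by linarith, by linarith⟩

theorem abs_sub_le_add {L x : ℝ} (hL : 0 ≤ L) (hx : 0 ≤ x) : |L - x| ≤ L + x :=
  abs_le.2 ⟨by linarith, by linarith⟩

/-- An edge of length `l 0` can be prepended to `ω` to give end distance `x`, and `ω` has distinct
ends. -/
structure Attachable {n : ℕ} (l : Fin (n + 1) → ℝ) (x : ℝ) (ω : Fin n → Circle) : Prop where
  pos : 0 < chainDist (Fin.tail l) ω
  lower : |l 0 - x| ≤ chainDist (Fin.tail l) ω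
  upper : chainDist (Fin.tail l) ω ≤ l 0 + x

theorem Attachable.inv {l : Fin (n + 1) → ℝ} {x : ℝ} {ω : Fin n → Circle} (h : Attachable l x ω) :
    Attachable l x ω⁻¹ := ⟨by simpa using h.pos, by simpa using h.lower, by simpa using h.upper⟩

/-- Clamp `g` between the lower bounds `|l 0 - α t|`, `m` and the upper bounds `l 0 + α t`, `B`.
Each lower bound is at most each upper bound because `α t` is in the range of end distances, so all
constraints hold, and `g` is unchanged wherever it already satisfied them. -/
theorem exists_tailDist (hL : 0 < l 0) (D : ChainData (Fin.tail l) m B G) {α g : ℝ → ℝ}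
    (hα : Continuous α) (hαr : ∀ t, α t ∈ Set.Icc (stepLo (l 0) m B) (l 0 + B))
    (hg : Continuous g) (hg0 : ∀ t, 0 < g t) :
    ∃ y : ℝ → ℝ, Continuous y ∧ (∀ t, 0 < y t) ∧ (∀ t, |l 0 - α t| ≤ y t) ∧
      (∀ t, y t ≤ l 0 + α t) ∧ (∀ t, y t ∈ Set.Icc m B) ∧
      ∀ t, |l 0 - α t| ≤ g t → g t ≤ l 0 + α t → g t ∈ Set.Icc m B → y t = g t := by
  refine ⟨fun t => max (max |l 0 - α t| m) (min (g t) (min (l 0 + α t) B)), by fun_prop,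
    ?_, ?_, ?_, ?_, ?_⟩
  · intro t
    obtain ⟨h₁, _, _, _⟩ := mem_stepIcc.1 (hαr t)
    exact lt_max_of_lt_right (lt_min (hg0 t) (lt_min (by linarith) D.pos))
  · intro t
    exact (le_max_left _ _).trans (le_max_left _ _)
  · intro t
    obtain ⟨h₁, _, h₃, _⟩ := mem_stepIcc.1 (hαr t)
    exact max_le (max_le (abs_sub_le_add hL.le h₁) (by linarith))
      ((min_le_right _ _).trans (min_le_left _ _))
  · intro t
    exact ⟨(le_max_right _ _).trans (le_max_left _ _),
      max_le (max_le (abs_sub_le_of_mem (hαr t)) D.le) ((min_le_right _ _).trans (min_le_right _ _))⟩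
  · intro t h₁ h₂ h₃
    change max (max |l 0 - α t| m) (min (g t) (min (l 0 + α t) B)) = g t
    rw [min_eq_left (le_min h₂ h₃.2), max_eq_right (max_le h₁ h₃.1)]

theorem attach_lift_or (hL : 0 < l 0) (D : ChainData (Fin.tail l) m B G) {α : ℝ → ℝ}
    {a a' b' b : ℝ} (h : IsPaused α a a' b' b)
    (hαr : ∀ t, α t ∈ Set.Icc (stepLo (l 0) m B) (l 0 + B)) {ω ω' : Fin (n + 1) → Circle}
    (hω : Attachable l (α a) ω) (hω' : Attachable l (α b) ω') :
    (∀ s : ℝ, s = 1 ∨ s = -1 →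
      LiftOn (chainDist l) α a b (attach l s (α a) ω) (attach l s (α b) ω')) ∨
    (∀ s : ℝ, s = 1 ∨ s = -1 →
      LiftOn (chainDist l) α a b (attach l s (α a) ω) (attach l s (α b) ω'⁻¹)) := by
  obtain ⟨_, h₁, h₂, h₃, _, _⟩ := id h
  -- Only half of each pause of `α` is passed on to `y`; the other half leaves `y` time to move.
  obtain ⟨g, hg, gl, gr, g0⟩ := exists_transition (p := (a + a') / 2) (q := (b' + b) / 2)
    (by linarith) hω.pos hω'.pos
  obtain ⟨y, hy, y0, yl, yu, yr, ye⟩ := exists_tailDist hL D h.cont hαr hg g0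
  have yA : ∀ t ∈ Set.Icc a ((a + a') / 2), y t = chainDist (Fin.tail l) ω := by
    intro t ht
    have := ye t
    rw [gl t ht.2, h.left t ⟨ht.1, by linarith [ht.2]⟩] at this
    exact this hω.lower hω.upper (D.range ω)
  have yB : ∀ t ∈ Set.Icc ((b' + b) / 2) b, y t = chainDist (Fin.tail l) ω' := by
    intro t ht
    have := ye t
    rw [gr t ht.1, h.right t ⟨by linarith [ht.1], ht.2⟩] at this
    exact this hω'.lower hω'.upper (D.range ω')
  have ya := yA a ⟨le_rfl, by linarith⟩
  have yb := yB b ⟨by linarith, le_rfl⟩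
  have hyp : IsPaused y a ((a + a') / 2) ((b' + b) / 2) b :=
    ⟨hy, by linarith, by linarith, by linarith, fun t ht => by rw [yA t ht, ya],
      fun t ht => by rw [yB t ht, yb]⟩
  have hα0 : ∀ t, 0 ≤ α t := fun t => (mem_stepIcc.1 (hαr t)).1
  refine (D.lift_or hyp yr ya.symm yb.symm).imp ?_ ?_ <;>
  · intro hl s hs
    exact hl.attach hL hs h.cont hα0 hy y0 yl yu

/-- Visiting `y₀ ∈ G` gives a tail lift with both ends prescribed; if `y₀` is moreover degenerate,
the sign may change during the visit. -/
theorem attach_lift_through (hL : 0 < l 0) (D : ChainData (Fin.tail l) m B G) {α : ℝ → ℝ}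
    {a a' b' b : ℝ} (h : IsPaused α a a' b' b)
    (hαr : ∀ t, α t ∈ Set.Icc (stepLo (l 0) m B) (l 0 + B)) {ω ω' : Fin (n + 1) → Circle}
    (hω : Attachable l (α a) ω) (hω' : Attachable l (α b) ω') {t₀ y₀ : ℝ}
    (ht₀ : t₀ ∈ Set.Icc a' b') (hy₀ : 0 < y₀) (hy₀G : y₀ ∈ G) (hy₀l : |l 0 - α t₀| ≤ y₀)
    (hy₀u : y₀ ≤ l 0 + α t₀) {s s' : ℝ} (hs : s = 1 ∨ s = -1) (hs' : s' = 1 ∨ s' = -1)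
    (hss : s = s' ∨ y₀ = |l 0 - α t₀| ∨ y₀ = l 0 + α t₀) :
    LiftOn (chainDist l) α a b (attach l s (α a) ω) (attach l s' (α b) ω') := by
  obtain ⟨_, h₁, h₂, h₃, _, _⟩ := id h
  obtain ⟨g, hg, gl, gr, g0, gt⟩ := exists_transition_through (p := (a + a') / 2) (t₀ := t₀)
    (q := (b' + b) / 2) (by linarith [ht₀.1]) (by linarith [ht₀.2]) hω.pos hy₀ hω'.pos
  obtain ⟨y, hy, y0, yl, yu, yr, ye⟩ := exists_tailDist hL D h.cont hαr hg g0
  have yA : ∀ t ∈ Set.Icc a ((a + a') / 2), y t = chainDist (Fin.tail l) ω := by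
    intro t ht
    have := ye t
    rw [gl t ht.2, h.left t ⟨ht.1, by linarith [ht.2]⟩] at this
    exact this hω.lower hω.upper (D.range ω)
  have yB : ∀ t ∈ Set.Icc ((b' + b) / 2) b, y t = chainDist (Fin.tail l) ω' := by
    intro t ht
    have := ye t
    rw [gr t ht.1, h.right t ⟨by linarith [ht.1], ht.2⟩] at this
    exact this hω'.lower hω'.upper (D.range ω')
  have yt : y t₀ = y₀ := by
    rw [ye t₀, gt] <;> rw [gt]
    exacts [hy₀l, hy₀u, D.subset hy₀G]
  have ya := yA a ⟨le_rfl, by linarith⟩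
  have yb := yB b ⟨by linarith, le_rfl⟩
  have hyp : IsPaused y a ((a + a') / 2) ((b' + b) / 2) b :=
    ⟨hy, by linarith, by linarith, by linarith, fun t ht => by rw [yA t ht, ya],
      fun t ht => by rw [yB t ht, yb]⟩
  have hα0 : ∀ t, 0 ≤ α t := fun t => (mem_stepIcc.1 (hαr t)).1
  have htab : t₀ ∈ Set.Icc a b := ⟨by linarith [ht₀.1], by linarith [ht₀.2]⟩
  have hl := D.lift hyp yr ya.symm yb.symm ⟨t₀, htab, by rw [yt]; exact hy₀G⟩
  rcases hss with rfl | hss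
  · exact hl.attach hL hs h.cont hα0 hy y0 yl yu
  · exact hl.attach_flip hL hs hs' htab h.cont hα0 hy y0 yl yu (by rw [yt]; exact hss)

/-- Lifts of a constant path are paths inside one fibre. -/
theorem isPaused_const (x : ℝ) : IsPaused (fun _ => x) 0 (1 / 3) (2 / 3) 1 :=
  ⟨continuous_const, by norm_num, by norm_num, by norm_num, fun _ _ => rfl, fun _ _ => rfl⟩

theorem attach_joined_or (hL : 0 < l 0) (D : ChainData (Fin.tail l) m B G) {x : ℝ}
    (hx : x ∈ Set.Icc (stepLo (l 0) m B) (l 0 + B)) {ω ω' : Fin (n + 1) → Circle}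
    (hω : Attachable l x ω) (hω' : Attachable l x ω') :
    (∀ s : ℝ, s = 1 ∨ s = -1 →
      JoinedIn {v | chainDist l v = x} (attach l s x ω) (attach l s x ω')) ∨
    (∀ s : ℝ, s = 1 ∨ s = -1 →
      JoinedIn {v | chainDist l v = x} (attach l s x ω) (attach l s x ω'⁻¹)) :=
  (attach_lift_or hL D (isPaused_const x) (fun _ => hx) hω hω').imp
    (fun h s hs => (h s hs).joinedIn) (fun h s hs => (h s hs).joinedIn)

theorem attach_joined_through (hL : 0 < l 0) (D : ChainData (Fin.tail l) m B G) {x : ℝ}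
    (hx : x ∈ Set.Icc (stepLo (l 0) m B) (l 0 + B)) {ω ω' : Fin (n + 1) → Circle}
    (hω : Attachable l x ω) (hω' : Attachable l x ω') {y₀ : ℝ}
    (hy₀ : 0 < y₀) (hy₀G : y₀ ∈ G) (hy₀l : |l 0 - x| ≤ y₀) (hy₀u : y₀ ≤ l 0 + x) {s : ℝ}
    (hs : s = 1 ∨ s = -1) :
    JoinedIn {v | chainDist l v = x} (attach l s x ω) (attach l s x ω') :=
  (attach_lift_through hL D (isPaused_const x) (fun _ => hx) hω hω' (t₀ := 1 / 2)
    ⟨by norm_num, by norm_num⟩ hy₀ hy₀G hy₀l hy₀u hs hs (Or.inl rfl)).joinedIn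

/-- Starting from a chain with closed tail, the tail can be opened inside the fibre. -/
theorem exists_joined_of_tail_closed (hL : 0 < l 0) (hL₁ : 0 < l 1) (hle : l 1 ≤ l 0)
    {ω₀ : Fin (n + 1) → Circle} (h₀ : chainVec (Fin.tail l) ω₀ = 0) :
    ∃ ω, Attachable l (l 0) ω ∧ ∀ (u : Circle) (s : ℝ), s = 1 ∨ s = -1 →
      JoinedIn {v | chainDist l v = l 0} (Fin.cons u ω₀) (attach l s (l 0) ω) := by
  set ω : ℝ → Fin (n + 1) → Circle := fun τ => Function.update ω₀ 0 (Circle.exp τ * ω₀ 0) with hω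
  set U : ℝ → Circle := fun τ => Circle.exp (Real.pi / 2 + τ / 2) * ω₀ 0 with hU
  have ht : Fin.tail l 0 = l 1 := rfl
  -- Turning the first tail edge by `τ` moves the tail vector from `0` along a chord of length `2 *
  -- l 1 * sin (τ / 2)`. Its direction `U τ` extends continuously to `τ = 0`, where `circleDir` does
  -- not see it.
  have hvec : ∀ τ, chainVec (Fin.tail l) (ω τ) = ((2 * l 1 * Real.sin (τ / 2) : ℝ) : ℂ) * U τ := by
    intro τ
    have e₁ : chainVec (Fin.tail l) (ω τ) =
        chainVec (Fin.tail l) ω₀ + l 1 * (Circle.exp τ * ω₀ 0 - ω₀ 0) := by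
      simp only [chainVec, Fin.sum_univ_succ, hω, Function.update_self, ht, Circle.coe_mul,
        Function.update_of_ne (Fin.succ_ne_zero _)]
      ring
    have e₂ : (Circle.exp τ : ℂ) = Complex.exp (τ / 2 * Complex.I) ^ 2 := by
      rw [Circle.coe_exp, ← Complex.exp_nat_mul]
      congr 1
      push_cast
      ring
    have e₃ : (Circle.exp (Real.pi / 2 + τ / 2) : ℂ) =
        Complex.I * Complex.exp (τ / 2 * Complex.I) := by
      rw [Circle.coe_exp]
      push_cast
      rw [add_mul, Complex.exp_add, Complex.exp_pi_div_two_mul_I]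
    rw [e₁, h₀, hU, Circle.coe_mul, e₂, e₃, Complex.exp_mul_I]
    push_cast
    linear_combination (l 1 * ω₀ 0 : ℂ) * (Complex.sin_sq_add_cos_sq (τ / 2 : ℂ) -
      Complex.sin (τ / 2) ^ 2 * Complex.I_sq)
  have hdist : ∀ τ, 0 ≤ Real.sin (τ / 2) →
      chainDist (Fin.tail l) (ω τ) = 2 * l 1 * Real.sin (τ / 2) := by
    intro τ hτ
    rw [chainDist, hvec, norm_mul, Circle.norm_coe, Complex.norm_real,
      Real.norm_of_nonneg (by positivity), mul_one]
  have hdpi : chainDist (Fin.tail l) (ω Real.pi) = 2 * l 1 := by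
    rw [hdist Real.pi (by simp), Real.sin_pi_div_two, mul_one]
  refine ⟨ω Real.pi, ⟨by rw [hdpi]; positivity, by rw [hdpi]; simp; positivity,
    by rw [hdpi]; linarith⟩, ?_⟩
  intro u s hs
  -- The triangle is isosceles with two sides `l 0`, so the cosine is minus half the base over `l
  -- 0`; `l 1 ≤ l 0` keeps it at least `-1` throughout the motion.
  have hturn : turnCos (l 0) (l 0) (2 * l 1) = -(l 1 / l 0) := by
    rw [turnCos]
    field_simp
    ring
  have hj : Joined u (U 0 * Circle.exp (s * Real.arccos (-(l 1 / l 0 * Real.sin (0 / 2))))) :=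
    PathConnectedSpace.joined _ _
  -- While the tail is closed the first edge rotates freely.
  have j₁ : JoinedIn {v | chainDist l v = l 0} (Fin.cons u ω₀)
      (Fin.cons (U 0 * Circle.exp (s * Real.arccos (-(l 1 / l 0 * Real.sin (0 / 2))))) ω₀) := by
    refine ((joinedIn_univ.2 hj).map (f := fun c => (Fin.cons c ω₀ : Fin (n + 2) → Circle))
      (Continuous.finCons continuous_id continuous_const)).mono ?_
    rintro _ ⟨c, -, rfl⟩
    change chainDist l _ = l 0
    rw [chainDist, chainVec_cons, h₀, add_zero, norm_mul, Circle.norm_coe, Complex.norm_real,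
      Real.norm_of_nonneg hL.le, mul_one]
  refine j₁.trans ?_
  refine JoinedIn.ofLine (f := fun τ => (Fin.cons (U (Real.pi * τ) *
    Circle.exp (s * Real.arccos (-(l 1 / l 0 * Real.sin (Real.pi * τ / 2))))) (ω (Real.pi * τ)) :
      Fin (n + 2) → Circle)) ?_ ?_ ?_ ?_
  · refine (Continuous.finCons (Continuous.mul ?_ ?_) ?_).continuousOn
    · exact (Circle.exp.continuous.comp (by fun_prop)).mul continuous_const
    · exact Circle.exp.continuous.comp
        (continuous_const.mul (Real.continuous_arccos.comp (by fun_prop)))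
    · exact continuous_const.update 0
        ((Circle.exp.continuous.comp (by fun_prop)).mul continuous_const)
  · simp [hω]
  · have : circleDir (chainVec (Fin.tail l) (ω Real.pi)) = U Real.pi := by
      rw [hvec, circleDir_norm_mul (by rw [Real.sin_pi_div_two]; positivity)]
    simp only [attach, this, hdpi, hturn, mul_one, Real.sin_pi_div_two]
  · rintro _ ⟨τ, hτ, rfl⟩
    have h1 : 0 ≤ Real.sin (Real.pi * τ / 2) := by
      refine Real.sin_nonneg_of_nonneg_of_le_pi ?_ ?_
      · have := hτ.1
        positivity
      · nlinarith [hτ.2, hτ.1, Real.pi_pos]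
    have h2 := Real.sin_le_one (Real.pi * τ / 2)
    have hq : l 1 / l 0 ≤ 1 := (div_le_one hL).2 hle
    have hq0 : 0 ≤ l 1 / l 0 := by positivity
    have hp0 : 0 ≤ l 1 / l 0 * Real.sin (Real.pi * τ / 2) := mul_nonneg hq0 h1
    have hp1 : l 1 / l 0 * Real.sin (Real.pi * τ / 2) ≤ 1 := mul_le_one₀ hq h1 h2
    change chainDist l _ = l 0
    rw [chainDist, chainVec_cons, hvec]
    refine norm_turn_of_cos _ hL.le ?_
    rw [cos_sign_mul hs, Real.cos_arccos (by linarith) (by linarith)]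
    field_simp
    ring

end Step

/-! ### Inductive step: the two partial reflections inside a fibre. -/

section Step

variable {n : ℕ} {l : Fin (n + 2) → ℝ} {m B : ℝ} {G : Set ℝ}

/-- Attaching needs a positive tail distance, so a good value `0` has to be replaced by another one;
`near_zero` is what makes this possible. -/
theorem exists_pos_mem (hL : 0 < l 0) (hle : l 1 ≤ l 0) (D : ChainData (Fin.tail l) m B G) {x : ℝ}
    (h : ∃ y ∈ G, |l 0 - x| ≤ y ∧ y ≤ l 0 + x) :
    ∃ y ∈ G, 0 < y ∧ |l 0 - x| ≤ y ∧ y ≤ l 0 + x := by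
  obtain ⟨y, hy, h₁, h₂⟩ := h
  rcases ((abs_nonneg _).trans h₁).eq_or_lt with h0 | h0
  · subst h0
    have hx : l 0 - x = 0 := abs_nonpos_iff.1 h₁
    rcases D.near_zero hy with ⟨η, hη, H⟩ | H
    · have hB := D.pos
      refine ⟨min (η / 2) (min (l 0) B), H _ ?_ ?_ ?_, ?_, ?_, ?_⟩
      · positivity
      · exact (min_le_left _ _).trans_lt (by linarith)
      · exact (min_le_right _ _).trans (min_le_right _ _)
      · positivity
      · rw [hx, abs_zero]
        positivity
      · exact ((min_le_right _ _).trans (min_le_left _ _)).trans (by linarith)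
    · have ht : Fin.tail l 0 = l 1 := rfl
      rw [ht] at H
      -- Here `B = 2 * l 1 ≤ 2 * l 0 = l 0 + x`, so the fully stretched tail fits.
      refine ⟨B, D.top_mem, D.pos, ?_, by linarith⟩
      rw [hx, abs_zero]
      exact D.pos.le
  · exact ⟨y, hy, h0, h₁, h₂⟩

theorem joined_attach_inv_tail (hL : 0 < l 0) (hle : l 1 ≤ l 0)
    (D : ChainData (Fin.tail l) m B G) {x s : ℝ} {ω : Fin (n + 1) → Circle}
    (hx : x ∈ Set.Icc (stepLo (l 0) m B) (l 0 + B)) (hω : Attachable l x ω)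
    (h : ∃ y ∈ G, |l 0 - x| ≤ y ∧ y ≤ l 0 + x) (hs : s = 1 ∨ s = -1) :
    JoinedIn {v | chainDist l v = x} (attach l s x ω) (attach l s x ω⁻¹) := by
  obtain ⟨y, hy, h0, h₁, h₂⟩ := exists_pos_mem hL hle D h
  exact attach_joined_through hL D hx hω hω.inv h0 hy h₁ h₂ hs

theorem neg_sign {s : ℝ} (hs : s = 1 ∨ s = -1) : -s = 1 ∨ -s = -1 := by
  rcases hs with rfl | rfl <;> simp

/-- Move the tail distance to `e` with one sign, where both signs agree, and return along the same
tails with the other sign. -/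
theorem joined_attach_neg_of_degenerate (hL : 0 < l 0) (D : ChainData (Fin.tail l) m B G)
    {x s e : ℝ} {ω : Fin (n + 1) → Circle} (hx : x ∈ Set.Icc (stepLo (l 0) m B) (l 0 + B))
    (hω : Attachable l x ω) (he0 : 0 < e) (he : e ∈ Set.Icc m B)
    (hd : e = |l 0 - x| ∨ e = l 0 + x) (hs : s = 1 ∨ s = -1) :
    JoinedIn {v | chainDist l v = x} (attach l s x ω) (attach l (-s) x ω) := by
  have hx0 := (mem_stepIcc.1 hx).1
  have hab := abs_sub_le_add hL.le hx0
  obtain ⟨ω', rfl⟩ := D.surj e he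
  have hω' : Attachable l x ω' := by
    refine ⟨he0, ?_, ?_⟩ <;> rcases hd with hd | hd <;> rw [hd]
    exacts [hab, hab]
  rcases attach_joined_or hL D hx hω hω' with H | H
  · refine (H s hs).trans ?_
    rw [← attach_neg_of_degenerate hL hs he0 hd]
    exact (H (-s) (neg_sign hs)).symm
  · refine (H s hs).trans ?_
    rw [← attach_neg_of_degenerate hL hs (by simpa using he0) (by simpa using hd)]
    exact (H (-s) (neg_sign hs)).symm

theorem joined_attach_neg (hL : 0 < l 0) (hL₁ : 0 < l 1) (hle : l 1 ≤ l 0)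
    (D : ChainData (Fin.tail l) m B G) {x s : ℝ} {ω : Fin (n + 1) → Circle}
    (hx : x ∈ Set.Icc (stepLo (l 0) m B) (l 0 + B)) (hω : Attachable l x ω)
    (h : x ≤ B - l 0 ∨ m ≤ |l 0 - x|) (hs : s = 1 ∨ s = -1) :
    JoinedIn {v | chainDist l v = x} (attach l s x ω) (attach l (-s) x ω) := by
  obtain ⟨h₁, h₂, h₃, h₄⟩ := mem_stepIcc.1 hx
  by_cases hxB : x ≤ B - l 0
  · exact joined_attach_neg_of_degenerate hL D hx hω (e := l 0 + x) (by linarith)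
      ⟨by linarith, by linarith⟩ (Or.inr rfl) hs
  replace h := h.resolve_left hxB
  -- If the degenerate length `|l 0 - x|` is `0`, pass instead through a closed tail, from which
  -- either sign can be reached.
  rcases (abs_nonneg (l 0 - x)).eq_or_lt with h0 | h0
  · rw [← h0] at h
    have hxL : x = l 0 := by
      have := abs_eq_zero.1 h0.symm
      linarith
    subst hxL
    obtain ⟨ω₀, hω₀⟩ := D.surj 0 ⟨h, D.pos.le⟩
    obtain ⟨ω', hω', H⟩ := exists_joined_of_tail_closed hL hL₁ hle (norm_eq_zero.1 hω₀)
    have key : ∀ s : ℝ, s = 1 ∨ s = -1 →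
        JoinedIn {v | chainDist l v = l 0} (attach l s (l 0) ω) (attach l s (l 0) ω') := by
      intro s hs
      exact attach_joined_through hL D hx hω hω' D.pos D.top_mem
        (by rw [← h0]; exact D.pos.le) (by linarith) hs
    exact (((key s hs).trans (H 1 s hs).symm).trans (H 1 (-s) (neg_sign hs))).trans
      (key (-s) (neg_sign hs)).symm
  · exact joined_attach_neg_of_degenerate hL D hx hω h0 ⟨h, abs_sub_le_of_mem hx⟩
      (Or.inl rfl) hs

theorem exists_joined_attach (hL : 0 < l 0) (hL₁ : 0 < l 1) (hle : l 1 ≤ l 0)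
    (z : Fin (n + 2) → Circle) :
    ∃ (ω : Fin (n + 1) → Circle) (s : ℝ), (s = 1 ∨ s = -1) ∧ Attachable l (chainDist l z) ω ∧
      JoinedIn {v | chainDist l v = chainDist l z} z (attach l s (chainDist l z) ω) := by
  obtain ⟨h₁, h₂⟩ := triangle_tail hL z
  rcases (chainDist_nonneg (Fin.tail l) (Fin.tail z)).eq_or_lt with h0 | h0
  · rw [← h0] at h₁
    have hd : chainDist l z = l 0 := by
      have := abs_nonpos_iff.1 h₁
      linarith
    obtain ⟨ω, hω, H⟩ := exists_joined_of_tail_closed hL hL₁ hle (norm_eq_zero.1 h0.symm)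
    have := H (z 0) 1 (Or.inl rfl)
    rw [Fin.cons_self_tail] at this
    rw [hd]
    exact ⟨ω, 1, Or.inl rfl, hω, this⟩
  · obtain ⟨s, hs, e⟩ := exists_eq_attach hL z h0
    refine ⟨Fin.tail z, s, hs, ⟨h0, h₁, h₂⟩, ?_⟩
    rw [← e]
    exact JoinedIn.refl rfl

/-! ### Inductive step: range, good set and separation. -/

theorem step_range (hL : 0 < l 0) (D : ChainData (Fin.tail l) m B G) (z : Fin (n + 2) → Circle) :
    chainDist l z ∈ Set.Icc (stepLo (l 0) m B) (l 0 + B) := by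
  obtain ⟨h₁, h₂⟩ := triangle_tail hL z
  obtain ⟨h₃, h₄⟩ := D.range (Fin.tail z)
  rw [abs_le] at h₁
  exact mem_stepIcc.2 ⟨chainDist_nonneg _ _, by linarith, by linarith, by linarith⟩

theorem step_surj (hL : 0 < l 0) (D : ChainData (Fin.tail l) m B G) {x : ℝ}
    (hx : x ∈ Set.Icc (stepLo (l 0) m B) (l 0 + B)) : ∃ z, chainDist l z = x := by
  obtain ⟨h₁, h₂, h₃, h₄⟩ := mem_stepIcc.1 hx
  obtain ⟨ω, hω⟩ := D.surj (min (l 0 + x) B) ⟨le_min (by linarith) D.le, min_le_right _ _⟩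
  refine ⟨attach l 1 x ω, chainDist_attach hL (Or.inl rfl) h₁ ?_ ?_ ?_⟩ <;> rw [hω]
  · exact lt_min (by linarith) D.pos
  · exact le_min (abs_sub_le_add hL.le h₁) (abs_sub_le_of_mem hx)
  · exact min_le_left _ _

theorem isClosed_stepSet {L : ℝ} (hG : IsCompact G) : IsClosed (stepSet L m B G) := by
  -- The condition with `∃ y ∈ G` is the projection of a compact set.
  have e : stepSet L m B G =
      (Prod.fst '' ((Set.Icc (stepLo L m B) (L + B) ×ˢ G) ∩
        {p : ℝ × ℝ | p.1 ≤ B - L ∧ |L - p.1| ≤ p.2 ∧ p.2 ≤ L + p.1})) ∪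
      (Set.Icc (stepLo L m B) (L + B) ∩ {x | B - L ≤ x ∧ m ≤ |L - x|}) := by
    ext x
    constructor
    · rintro ⟨hx, ⟨h, y, hy, h₁, h₂⟩ | h⟩
      · exact Or.inl ⟨(x, y), ⟨⟨hx, hy⟩, h, h₁, h₂⟩, rfl⟩
      · exact Or.inr ⟨hx, h⟩
    · rintro (⟨⟨x, y⟩, ⟨⟨hx, hy⟩, h, h₁, h₂⟩, rfl⟩ | ⟨hx, h⟩)
      · exact ⟨hx, Or.inl ⟨h, y, hy, h₁, h₂⟩⟩
      · exact ⟨hx, Or.inr h⟩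
  rw [e]
  refine IsClosed.union ?_ (isClosed_Icc.inter ?_)
  · refine (((isCompact_Icc.prod hG).inter_right ?_).image continuous_fst).isClosed
    refine IsClosed.inter (isClosed_le (f := fun p : ℝ × ℝ => p.1) (g := fun _ => B - L) ?_ ?_)
      (IsClosed.inter (isClosed_le (f := fun p : ℝ × ℝ => |L - p.1|) (g := fun p => p.2) ?_ ?_)
        (isClosed_le (f := fun p : ℝ × ℝ => p.2) (g := fun p => L + p.1) ?_ ?_)) <;> fun_prop
  · refine IsClosed.inter (isClosed_le (f := fun _ : ℝ => B - L) (g := fun x => x) ?_ ?_)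
      (isClosed_le (f := fun _ : ℝ => m) (g := fun x => |L - x|) ?_ ?_) <;> fun_prop

/-- At a boundary point of `stepSet` a single length of the tail allows both to reflect the tail
and to reflect the first edge. -/
theorem exists_degenerate_of_frequently (hL : 0 < l 0) (hle : l 1 ≤ l 0)
    (D : ChainData (Fin.tail l) m B G) {x₀ : ℝ} (hx₀ : x₀ ∈ stepSet (l 0) m B G)
    (hf : ∃ᶠ x in nhds x₀,
      x ∈ Set.Icc (stepLo (l 0) m B) (l 0 + B) ∧ x ∉ stepSet (l 0) m B G) :
    ∃ y ∈ G, 0 < y ∧ |l 0 - x₀| ≤ y ∧ y ≤ l 0 + x₀ ∧ (y = |l 0 - x₀| ∨ y = l 0 + x₀) := by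
  have hB := D.pos
  obtain ⟨hx, hor⟩ := hx₀
  obtain ⟨h₁, h₂, h₃, h₄⟩ := mem_stepIcc.1 hx
  have hab := abs_sub_le_add hL.le h₁
  rcases lt_trichotomy x₀ (B - l 0) with hlt | heq | hgt
  · have hev : ∀ᶠ x in nhds x₀, x < B - l 0 := eventually_lt_nhds hlt
    obtain ⟨y, hy, hy₁, hy₂⟩ : ∃ y ∈ G, |l 0 - x₀| ≤ y ∧ y ≤ l 0 + x₀ := by
      rcases hor with h | h
      · exact h.2
      · linarith [h.1]
    rcases hy₁.eq_or_lt with e₁ | e₁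
    · rcases ((abs_nonneg _).trans hy₁).eq_or_lt with h0 | h0
      · exfalso
        have hxL : l 0 - x₀ = 0 := abs_eq_zero.1 (e₁.trans h0.symm)
        rcases D.near_zero (h0 ▸ hy) with ⟨η, hη, H⟩ | H
        · have hev' : ∀ᶠ x in nhds x₀, |l 0 - x| < η := by
            refine ContinuousAt.eventually_lt (by fun_prop) continuousAt_const ?_
            rw [hxL, abs_zero]
            exact hη
          obtain ⟨x, ⟨hxI, hxG⟩, hxB, hxη⟩ := (hf.and_eventually (hev.and hev')).exists
          -- `G` contains all small tail distances, so `|l 0 - x|` itself shows that nearby `x` are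
          -- good.
          refine hxG ⟨hxI, Or.inl ⟨hxB.le, |l 0 - x|, ?_, le_rfl,
            abs_sub_le_add hL.le (mem_stepIcc.1 hxI).1⟩⟩
          exact H _ (abs_nonneg _) hxη (abs_sub_le_of_mem hxI)
        · have ht : Fin.tail l 0 = l 1 := rfl
          rw [ht] at H
          -- `B = 2 * l 1 ≤ 2 * l 0` contradicts `x₀ = l 0 < B - l 0`.
          linarith
      · exact ⟨y, hy, h0, hy₁, hy₂, Or.inl e₁.symm⟩
    · rcases hy₂.eq_or_lt with e₂ | e₂
      · exact ⟨y, hy, (abs_nonneg _).trans_lt e₁, hy₁, hy₂, Or.inr e₂⟩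
      -- A good `y` strictly inside the window stays admissible for nearby `x`, so `x₀` would not be
      -- a boundary point.
      · exfalso
        have hev₁ : ∀ᶠ x in nhds x₀, |l 0 - x| < y :=
          ContinuousAt.eventually_lt (by fun_prop) continuousAt_const e₁
        have hev₂ : ∀ᶠ x in nhds x₀, y < l 0 + x :=
          ContinuousAt.eventually_lt continuousAt_const (by fun_prop) e₂
        obtain ⟨x, ⟨hxI, hxG⟩, hxB, hx₁, hx₂⟩ :=
          (hf.and_eventually (hev.and (hev₁.and hev₂))).exists
        exact hxG ⟨hxI, Or.inl ⟨hxB.le, y, hy, hx₁.le, hx₂.le⟩⟩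
  · exact ⟨B, D.top_mem, hB, abs_sub_le_of_mem hx, by linarith, Or.inr (by linarith)⟩
  · have hev : ∀ᶠ x in nhds x₀, B - l 0 < x := eventually_gt_nhds hgt
    have hm : m ≤ |l 0 - x₀| := by
      rcases hor with h | h
      · linarith [h.1]
      · exact h.2
    have hf' : ∃ᶠ x in nhds x₀, |l 0 - x| < m := by
      refine (hf.and_eventually hev).mono ?_
      rintro x ⟨⟨hxI, hxG⟩, hxB⟩
      by_contra hcon
      exact hxG ⟨hxI, Or.inr ⟨hxB.le, not_lt.1 hcon⟩⟩
    obtain ⟨x, hx'⟩ := hf'.exists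
    have hm0 : 0 < m := (abs_nonneg _).trans_lt hx'
    -- The inequality `m ≤ |l 0 - x|` holds at `x₀` but fails arbitrarily close to it, which forces
    -- equality.
    have hm' : |l 0 - x₀| ≤ m := by
      by_contra hcon
      have : ∀ᶠ x in nhds x₀, m < |l 0 - x| :=
        ContinuousAt.eventually_lt continuousAt_const (by fun_prop) (not_le.1 hcon)
      obtain ⟨x, hx₁, hx₂⟩ := (hf'.and_eventually this).exists
      exact lt_asymm hx₁ hx₂
    exact ⟨m, D.bot_mem hm0, hm0, hm', by linarith, Or.inl (le_antisymm hm hm')⟩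

/-- End distance `0` forces tail distance `l 0`. Unless `B = l 0`, this length is in `G`, and it
stays admissible for all small `x`. -/
theorem step_near_zero (hL : 0 < l 0)
    (h : 0 ∈ stepSet (l 0) m B G) :
    (∃ η > 0, ∀ x, 0 ≤ x → x < η → x ≤ l 0 + B → x ∈ stepSet (l 0) m B G) ∨
      l 0 + B = 2 * l 0 := by
  obtain ⟨hI, hor⟩ := h
  obtain ⟨-, h₂, h₃, -⟩ := mem_stepIcc.1 hI
  have hI' : ∀ x, 0 ≤ x → x ≤ l 0 + B → x ∈ Set.Icc (stepLo (l 0) m B) (l 0 + B) :=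
    fun x h0 h1 => mem_stepIcc.2 ⟨h0, by linarith, by linarith, h1⟩
  by_cases hB : B = l 0
  · right
    linarith
  left
  have hlt : l 0 < B := lt_of_le_of_ne (by linarith) (Ne.symm hB)
  have hG : l 0 ∈ G := by
    rcases hor with ⟨-, y, hy, h₄, h₅⟩ | h
    · rw [sub_zero, abs_of_pos hL] at h₄
      rwa [show l 0 = y by linarith]
    · linarith [h.1]
  refine ⟨min (B - l 0) (l 0), lt_min (by linarith) hL, fun x h0 hx h1 => ?_⟩
  have hx₁ := hx.trans_le (min_le_left _ _)
  have hx₂ := hx.trans_le (min_le_right _ _)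
  exact ⟨hI' x h0 h1, Or.inl ⟨hx₁.le, l 0, hG, abs_le.2 ⟨by linarith, by linarith⟩, by linarith⟩⟩

theorem tail_rotateAll (c : Circle) (z : Fin (n + 2) → Circle) :
    Fin.tail (rotateAll c z) = rotateAll c (Fin.tail z) := rfl

/-- Sets `J` of values, rather than single ones, are needed for the induction: even one `x` allows
an interval of tail distances, over all of which the tail's function must not vanish. -/
theorem step_sep (hL : 0 < l 0) (D : ChainData (Fin.tail l) m B G) {J : Set ℝ}
    (hJ : J.OrdConnected)
    (hJG : J ⊆ Set.Icc (stepLo (l 0) m B) (l 0 + B) \ stepSet (l 0) m B G) :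
    ∃ g : (Fin (n + 2) → Circle) → ℝ, Continuous g ∧ (∀ z, g z⁻¹ = -g z) ∧
      (∀ c z, g (rotateAll c z) = g z) ∧ ∀ z, chainDist l z ∈ J → g z ≠ 0 := by
  have hB := D.pos
  -- At `x = B - l 0` the value `y = B` is good and flat, so `J` lies strictly on one side.
  have hne : ∀ x ∈ J, x ≠ B - l 0 := by
    rintro x hx rfl
    refine (hJG hx).2 ⟨(hJG hx).1, Or.inl ⟨le_rfl, B, D.top_mem, abs_sub_le_of_mem (hJG hx).1, ?_⟩⟩
    linarith
  by_cases hall : ∃ x ∈ J, x < B - l 0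
  · obtain ⟨x₁, hx₁, hx₁B⟩ := hall
    have hlt : ∀ x ∈ J, x < B - l 0 := by
      intro x hx
      by_contra hcon
      exact hne _ (hJ.out hx₁ hx ⟨hx₁B.le, not_lt.1 hcon⟩) rfl
    set J' : Set ℝ := {y | y ∈ Set.Icc m B ∧ ∃ x ∈ J, |l 0 - x| ≤ y ∧ y ≤ l 0 + x} with hJ'
    have hJ'o : J'.OrdConnected := by
      refine ⟨?_⟩
      rintro y₁ ⟨hy₁, u, hu, hu₁, hu₂⟩ y₂ ⟨hy₂, v, hv, hv₁, hv₂⟩ y hy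
      refine ⟨⟨hy₁.1.trans hy.1, hy.2.trans hy₂.2⟩, ?_⟩
      rcases le_total y (l 0 + u) with h | h
      · exact ⟨u, hu, hu₁.trans hy.1, h⟩
      · have hu0 := (mem_stepIcc.1 (hJG hu).1).1
        exact ⟨y - l 0, hJ.out hu hv ⟨by linarith, by linarith [hy.2]⟩,
          abs_le.2 ⟨by linarith, by linarith⟩, by linarith⟩
    have hJ'G : J' ⊆ Set.Icc m B \ G := by
      rintro y ⟨hy, x, hx, h₁, h₂⟩
      exact ⟨hy, fun hyG => (hJG hx).2 ⟨(hJG hx).1, Or.inl ⟨(hlt x hx).le, y, hyG, h₁, h₂⟩⟩⟩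
    obtain ⟨g, hg, hinv, hrot, hg0⟩ := D.sep J' hJ'o hJ'G
    refine ⟨fun z => g (Fin.tail z), ?_, fun z => hinv (Fin.tail z),
      fun c z => hrot c (Fin.tail z), fun z hz => hg0 _ ⟨D.range _, _, hz, triangle_tail hL z⟩⟩
    refine hg.comp ?_
    unfold Fin.tail
    fun_prop
  · have hgt : ∀ x ∈ J, B - l 0 < x := fun x hx =>
      lt_of_le_of_ne (not_lt.1 fun h => hall ⟨x, hx, h⟩) (hne x hx).symm
    -- Up to a constant factor this is the signed area of the triangle.
    refine ⟨fun z => ((starRingEnd ℂ) (z 0 : ℂ) * chainVec (Fin.tail l) (Fin.tail z)).im,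
      ?_, ?_, ?_, ?_⟩
    · have : Continuous fun z : Fin (n + 2) → Circle => chainVec (Fin.tail l) (Fin.tail z) := by
        refine (continuous_chainVec _).comp ?_
        unfold Fin.tail
        fun_prop
      refine Complex.continuous_im.comp (Continuous.mul ?_ this)
      exact Complex.continuous_conj.comp (continuous_coe_circle.comp (continuous_apply 0))
    · intro z
      have : chainVec (Fin.tail l) (Fin.tail z⁻¹) =
          (starRingEnd ℂ) (chainVec (Fin.tail l) (Fin.tail z)) := chainVec_inv _ _
      simp only
      rw [this, Pi.inv_apply, Circle.coe_inv_eq_conj, ← map_mul, Complex.conj_im]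
    · intro c z
      have hc : (starRingEnd ℂ) (c : ℂ) * c = 1 := by
        rw [← Circle.coe_inv_eq_conj, Circle.coe_inv, inv_mul_cancel₀ c.coe_ne_zero]
      simp only [tail_rotateAll, chainVec_rotateAll]
      congr 1
      simp only [rotateAll, Circle.coe_mul, map_mul]
      linear_combination (starRingEnd ℂ) (z 0 : ℂ) * chainVec (Fin.tail l) (Fin.tail z) * hc
    · intro z hz h0
      have hz0 : (z 0 : ℂ) * (starRingEnd ℂ) (z 0 : ℂ) = 1 := by
        rw [← Circle.coe_inv_eq_conj, Circle.coe_inv, mul_inv_cancel₀ (z 0).coe_ne_zero]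
      -- Zero area means a flat triangle. That would need `y = |l 0 - x|`, which is below `m`, or `y
      -- = l 0 + x`, which exceeds `B`.
      set r := ((starRingEnd ℂ) (z 0 : ℂ) * chainVec (Fin.tail l) (Fin.tail z)).re with hr
      have hre : (starRingEnd ℂ) (z 0 : ℂ) * chainVec (Fin.tail l) (Fin.tail z) = (r : ℂ) :=
        Complex.ext rfl h0
      have hW : chainVec (Fin.tail l) (Fin.tail z) = z 0 * (r : ℂ) := by
        rw [← hre, ← mul_assoc, hz0, one_mul]
      have hy : chainDist (Fin.tail l) (Fin.tail z) = |r| := by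
        rw [chainDist, hW, norm_mul, Circle.norm_coe, Complex.norm_real, one_mul, Real.norm_eq_abs]
      have hx : chainDist l z = |l 0 + r| := by
        rw [chainDist, ← Fin.cons_self_tail z, chainVec_cons, hW,
          show (l 0 : ℂ) * z 0 + z 0 * r = z 0 * ((l 0 + r : ℝ) : ℂ) by push_cast; ring,
          norm_mul, Circle.norm_coe, Complex.norm_real, one_mul, Real.norm_eq_abs]
      have hyI := D.range (Fin.tail z)
      have hgz := hgt _ hz
      have hm : |l 0 - chainDist l z| < m := by
        by_contra hcon
        exact (hJG hz).2 ⟨(hJG hz).1, Or.inr ⟨hgz.le, not_lt.1 hcon⟩⟩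
      rw [hy] at hyI
      rw [hx] at hm hgz
      rw [abs_lt] at hm
      obtain ⟨hy₁, hy₂⟩ := hyI
      rcases abs_cases r with ⟨h₁, h₁'⟩ | ⟨h₁, h₁'⟩ <;>
        rcases abs_cases (l 0 + r) with ⟨h₂, h₂'⟩ | ⟨h₂, h₂'⟩ <;> linarith

end Step

/-! ### Inductive step: lifting paths. -/

section Step

variable {n : ℕ} {l : Fin (n + 2) → ℝ} {m B : ℝ} {G : Set ℝ}

theorem step_top_mem (D : ChainData (Fin.tail l) m B G) (hL : 0 < l 0) :
    l 0 + B ∈ stepSet (l 0) m B G := by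
  have h₁ := D.pos
  have h₂ := D.le
  refine ⟨mem_stepIcc.2 ⟨by linarith, by linarith, by linarith, le_rfl⟩,
    Or.inr ⟨by linarith, ?_⟩⟩
  rw [show l 0 - (l 0 + B) = -B by ring, abs_neg, abs_of_pos h₁]
  exact h₂

theorem stepLo_le (D : ChainData (Fin.tail l) m B G) (hL : 0 < l 0) :
    stepLo (l 0) m B ≤ l 0 + B := by
  have h₁ := D.pos
  have h₂ := D.le
  exact max_le (by linarith) (max_le (by linarith) (by linarith))

theorem step_bot_mem (D : ChainData (Fin.tail l) m B G) (hL : 0 < l 0)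
    (h : 0 < stepLo (l 0) m B) : stepLo (l 0) m B ∈ stepSet (l 0) m B G := by
  have h₁ := D.pos
  have h₂ := D.le
  have h₀ := D.nonneg
  have hmem : stepLo (l 0) m B ∈ Set.Icc (stepLo (l 0) m B) (l 0 + B) := ⟨le_rfl, stepLo_le D hL⟩
  refine ⟨hmem, ?_⟩
  have e : stepLo (l 0) m B = max (l 0 - B) (m - l 0) := by
    unfold stepLo at h ⊢
    exact max_eq_right ((lt_max_iff.1 h).resolve_left (lt_irrefl _)).le
  rcases max_choice (l 0 - B) (m - l 0) with h' | h' <;> rw [h'] at e <;> rw [e] at h ⊢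
  · refine Or.inr ⟨by linarith, ?_⟩
    rw [sub_sub_cancel, abs_of_pos h₁]
    exact h₂
  · refine Or.inl ⟨by linarith, m, D.bot_mem (by linarith), abs_le.2 ⟨?_, ?_⟩, ?_⟩ <;> linarith

theorem exists_tail_mem_of_le (D : ChainData (Fin.tail l) m B G) {x : ℝ}
    (hx : x ∈ Set.Icc (stepLo (l 0) m B) (l 0 + B)) (h : B - l 0 ≤ x) :
    ∃ y ∈ G, |l 0 - x| ≤ y ∧ y ≤ l 0 + x :=
  ⟨B, D.top_mem, abs_sub_le_of_mem hx, by linarith⟩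

theorem joined_inv_of_mem (hL : 0 < l 0) (hL₁ : 0 < l 1) (hle : l 1 ≤ l 0)
    (D : ChainData (Fin.tail l) m B G) {x : ℝ} {z : Fin (n + 2) → Circle} (hz : chainDist l z = x)
    (hx : x ∈ stepSet (l 0) m B G) : JoinedIn {v | chainDist l v = x} z z⁻¹ := by
  subst hz
  obtain ⟨ω, s, hs, hω, hj⟩ := exists_joined_attach hL hL₁ hle z
  have h₁ := joined_attach_neg hL hL₁ hle D hx.1 hω (hx.2.imp (·.1) (·.2)) hs
  have h₂ := joined_attach_inv_tail hL hle D hx.1 hω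
    (hx.2.elim (·.2) fun h => exists_tail_mem_of_le D hx.1 h.1) (neg_sign hs)
  rw [← attach_inv] at h₂
  exact ((hj.trans h₁).trans h₂).trans hj.chain_inv.symm

theorem IsPaused.shrink {α : ℝ → ℝ} {a a' b' b : ℝ} (h : IsPaused α a a' b' b) :
    IsPaused α ((a + a') / 2) a' b' ((b' + b) / 2) ∧
      (∀ t ∈ Set.Icc a ((a + a') / 2), α t = α a) ∧
      (∀ t ∈ Set.Icc ((b' + b) / 2) b, α t = α b) ∧
      α ((a + a') / 2) = α a ∧ α ((b' + b) / 2) = α b := by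
  obtain ⟨hc, h₁, h₂, h₃, h₄, h₅⟩ := h
  have e₁ : α ((a + a') / 2) = α a := h₄ _ ⟨by linarith, by linarith⟩
  have e₂ : α ((b' + b) / 2) = α b := h₅ _ ⟨by linarith, by linarith⟩
  refine ⟨⟨hc, by linarith, h₂, by linarith, ?_, ?_⟩, ?_, ?_, e₁, e₂⟩
  · intro t ht
    rw [e₁, h₄ t ⟨by linarith [ht.1], ht.2⟩]
  · intro t ht
    rw [e₂, h₅ t ⟨ht.1, by linarith [ht.2]⟩]
  · exact fun t ht => h₄ t ⟨ht.1, by linarith [ht.2]⟩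
  · exact fun t ht => h₅ t ⟨by linarith [ht.1], ht.2⟩

/-- A lift over the shortened interval extends by paths in the fibres over the ends. -/
theorem LiftOn.extend {X : Type*} [TopologicalSpace X] {f : X → ℝ} {α : ℝ → ℝ} {a a' b' b : ℝ}
    (h : IsPaused α a a' b' b) {z z' w' w : X} (hz : JoinedIn {v | f v = α a} z z')
    (hl : LiftOn f α ((a + a') / 2) ((b' + b) / 2) z' w')
    (hw : JoinedIn {v | f v = α b} w' w) : LiftOn f α a b z w := by
  obtain ⟨_, h₁, h₂, h₃, _, _⟩ := id h
  obtain ⟨_, hA, hB, _, _⟩ := h.shrink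
  refine (LiftOn.trans (LiftOn.of_joinedIn hz (by linarith) hA) hl (by linarith)
    (by linarith)).trans (LiftOn.of_joinedIn hw (by linarith) hB) (by linarith) (by linarith)

theorem step_lift_or (hL : 0 < l 0) (hL₁ : 0 < l 1) (hle : l 1 ≤ l 0)
    (D : ChainData (Fin.tail l) m B G) {α : ℝ → ℝ} {a a' b' b : ℝ} (h : IsPaused α a a' b' b)
    (hα : ∀ t, α t ∈ Set.Icc (stepLo (l 0) m B) (l 0 + B)) {z w : Fin (n + 2) → Circle}
    (hz : chainDist l z = α a) (hw : chainDist l w = α b) :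
    LiftOn (chainDist l) α a b z w ∨ LiftOn (chainDist l) α a b z w⁻¹ := by
  obtain ⟨h', hA, hB, ea, eb⟩ := h.shrink
  obtain ⟨ω, s, hs, hω, hj⟩ := exists_joined_attach hL hL₁ hle z
  obtain ⟨ω', s', hs', hω', hj'⟩ := exists_joined_attach hL hL₁ hle w
  rw [hz] at hω hj
  rw [hw] at hω' hj'
  have hji := hj'.chain_inv
  rw [attach_inv] at hji
  have hcore := attach_lift_or hL D h' hα (by rwa [ea]) (by rwa [eb] : Attachable l _ ω')
  rw [ea, eb] at hcore
  have hcore : ∃ τ, (τ = ω' ∨ τ = ω'⁻¹) ∧ LiftOn (chainDist l) α ((a + a') / 2) ((b' + b) / 2)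
      (attach l s (α a) ω) (attach l s (α b) τ) := by
    rcases hcore with H | H
    · exact ⟨ω', Or.inl rfl, H s hs⟩
    · exact ⟨ω'⁻¹, Or.inr rfl, H s hs⟩
  obtain ⟨τ, hτ, H⟩ := hcore
  have hτa : Attachable l (α b) τ := by
    rcases hτ with rfl | rfl
    exacts [hω', hω'.inv]
  have hjoin : ∀ v, JoinedIn {v | chainDist l v = α b} v (attach l s (α b) τ) →
      LiftOn (chainDist l) α a b z v := fun v hv => H.extend h hj hv.symm
  -- At any end distance one of the two partial reflections can be carried out inside the fibre;
  -- combined with the global reflection this settles all four cases.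
  have hflip : JoinedIn {v | chainDist l v = α b} (attach l s (α b) τ) (attach l (-s) (α b) τ) ∨
      JoinedIn {v | chainDist l v = α b} (attach l s (α b) τ) (attach l s (α b) τ⁻¹) := by
    rcases le_total (α b) (B - l 0) with hb | hb
    · exact Or.inl (joined_attach_neg hL hL₁ hle D (hα b) hτa (Or.inl hb) hs)
    · exact Or.inr (joined_attach_inv_tail hL hle D (hα b) hτa
        (exists_tail_mem_of_le D (hα b) hb) hs)
  have hs2 : s' = s ∨ s' = -s := by
    rcases hs with rfl | rfl <;> rcases hs' with rfl | rfl <;> simp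
  rcases hτ with rfl | rfl <;> rcases hs2 with rfl | rfl
  · exact Or.inl (hjoin _ hj')
  · rw [neg_neg] at hji
    rcases hflip with hf | hf
    · exact Or.inl (hjoin _ (hj'.trans hf.symm))
    · exact Or.inr (hjoin _ (hji.trans hf.symm))
  · rw [inv_inv] at hflip
    rcases hflip with hf | hf
    · exact Or.inr (hjoin _ (hji.trans hf.symm))
    · exact Or.inl (hjoin _ (hj'.trans hf.symm))
  · rw [neg_neg] at hji
    exact Or.inr (hjoin _ hji)

theorem step_lift (hL : 0 < l 0) (hL₁ : 0 < l 1) (hle : l 1 ≤ l 0)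
    (D : ChainData (Fin.tail l) m B G) {α : ℝ → ℝ} {a a' b' b : ℝ} (h : IsPaused α a a' b' b)
    (hα : ∀ t, α t ∈ Set.Icc (stepLo (l 0) m B) (l 0 + B)) {z w : Fin (n + 2) → Circle}
    (hz : chainDist l z = α a) (hw : chainDist l w = α b)
    (hmeet : ∃ t ∈ Set.Icc a b, α t ∈ stepSet (l 0) m B G) :
    LiftOn (chainDist l) α a b z w := by
  obtain ⟨_, h₁, h₂, h₃, h₄, h₅⟩ := id h
  obtain ⟨h', hA, hB, ea, eb⟩ := h.shrink
  have hmid := step_lift_or hL hL₁ hle D h' hα (hz.trans ea.symm) (hw.trans eb.symm)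
  -- If an end value is good, its fibre joins a configuration to its mirror image, which absorbs the
  -- reflection left by `step_lift_or`.
  by_cases hGa : α a ∈ stepSet (l 0) m B G
  · have hzz := joined_inv_of_mem hL hL₁ hle D hz hGa
    rcases hmid with H | H
    · exact H.extend h (JoinedIn.refl hz) (JoinedIn.refl hw)
    · have H' := H.chain_inv
      rw [inv_inv] at H'
      exact H'.extend h hzz (JoinedIn.refl hw)
  by_cases hGb : α b ∈ stepSet (l 0) m B G
  · have hww := joined_inv_of_mem hL hL₁ hle D hw hGb
    rcases hmid with H | H
    · exact H.extend h (JoinedIn.refl hz) (JoinedIn.refl hw)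
    · exact H.extend h (JoinedIn.refl hz) hww.symm
  have hGcl : IsClosed (stepSet (l 0) m B G) :=
    isClosed_stepSet (isCompact_Icc.of_isClosed_subset D.closed D.subset)
  -- Its infimum is the first meeting with the good set. It is not inside a pause, since neither end
  -- value is good, and the values just before it are bad.
  set S : Set ℝ := Set.Icc a b ∩ α ⁻¹' stepSet (l 0) m B G with hS
  have hSc : IsClosed S := isClosed_Icc.inter (hGcl.preimage h.cont)
  have hSne : S.Nonempty := hmeet
  have hSb : BddBelow S := ⟨a, fun t ht => ht.1.1⟩
  have ht₀ : sInf S ∈ S := hSc.csInf_mem hSne hSb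
  set t₀ := sInf S with ht₀d
  obtain ⟨⟨hat, htb⟩, htG⟩ := ht₀
  have ht₀I : t₀ ∈ Set.Icc a' b' := by
    constructor
    · by_contra hcon
      exact hGa (h₄ t₀ ⟨hat, (not_le.1 hcon).le⟩ ▸ htG)
    · by_contra hcon
      exact hGb (h₅ t₀ ⟨(not_le.1 hcon).le, htb⟩ ▸ htG)
  have hfreq : ∃ᶠ x in nhds (α t₀),
      x ∈ Set.Icc (stepLo (l 0) m B) (l 0 + B) ∧ x ∉ stepSet (l 0) m B G := by
    have htend : Filter.Tendsto α (nhdsWithin t₀ (Set.Iio t₀)) (nhds (α t₀)) :=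
      h.cont.continuousAt.tendsto.mono_left nhdsWithin_le_nhds
    refine htend.frequently (Filter.Eventually.frequently ?_)
    have hev : Set.Ioo a t₀ ∈ nhdsWithin t₀ (Set.Iio t₀) :=
      Ioo_mem_nhdsLT (h₁.trans_le ht₀I.1)
    filter_upwards [hev] with t ht
    refine ⟨hα t, fun hcon => ?_⟩
    have : t₀ ≤ t := csInf_le hSb ⟨⟨ht.1.le, ht.2.le.trans htb⟩, hcon⟩
    exact absurd ht.2 (not_lt.2 this)
  obtain ⟨y₀, hyG, hy0, hyl, hyu, hyd⟩ := exists_degenerate_of_frequently hL hle D htG hfreq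
  obtain ⟨ω, s, hs, hω, hj⟩ := exists_joined_attach hL hL₁ hle z
  obtain ⟨ω', s', hs', hω', hj'⟩ := exists_joined_attach hL hL₁ hle w
  rw [hz] at hω hj
  rw [hw] at hω' hj'
  have H := attach_lift_through hL D h' hα (by rwa [ea]) (by rwa [eb] : Attachable l _ ω') ht₀I hy0
    hyG hyl hyu hs hs' (Or.inr hyd)
  rw [ea, eb] at H
  exact H.extend h hj hj'.symm

theorem ChainData.step (hL : 0 < l 0) (hL₁ : 0 < l 1) (hle : l 1 ≤ l 0)
    (D : ChainData (Fin.tail l) m B G) :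
    ChainData l (stepLo (l 0) m B) (l 0 + B) (stepSet (l 0) m B G) where
  nonneg := le_max_left _ _
  pos := add_pos hL D.pos
  le := stepLo_le D hL
  range := step_range hL D
  surj _ hx := step_surj hL D hx
  closed := isClosed_stepSet (isCompact_Icc.of_isClosed_subset D.closed D.subset)
  subset _ hx := hx.1
  top_mem := step_top_mem D hL
  bot_mem := step_bot_mem D hL
  near_zero := step_near_zero hL
  sep _ hJ hJG := step_sep hL D hJ hJG
  lift_or h hα _ _ hz hw := step_lift_or hL hL₁ hle D h hα hz hw
  lift h hα _ _ hz hw hm := step_lift hL hL₁ hle D h hα hz hw hm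

end Step

/-! ### Chains of arbitrary positive lengths. -/

theorem exists_chainData_of_antitone {n : ℕ} (l : Fin (n + 1) → ℝ) (hl : ∀ i, 0 < l i)
    (ha : Antitone l) : ∃ m M G, ChainData l m M G := by
  induction n with
  | zero => exact ⟨_, _, _, chainData_single l (hl 0)⟩
  | succ n ih =>
    obtain ⟨m, B, G, D⟩ := ih (Fin.tail l) (fun i => hl i.succ)
      (fun i j hij => ha (Fin.succ_le_succ_iff.2 hij))
    exact ⟨_, _, _, D.step (hl 0) (hl 1) (ha (Fin.zero_le 1))⟩

/-- Path lifting for the end distance of a chain: there is a set `G` of end distances such that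
paths which pause at both ends and meet `G` lift with prescribed end points, and outside of `G` the
fibres are separated by a rotation invariant function. -/
theorem exists_chain_lifting {n : ℕ} (l : Fin (n + 1) → ℝ) (hl : ∀ i, 0 < l i) :
    ∃ G : Set ℝ,
      (∀ x ∈ Set.range (chainDist l), x ∉ G →
        ∃ g : (Fin (n + 1) → Circle) → ℝ, Continuous g ∧ (∀ z, g z⁻¹ = -g z) ∧
          (∀ c z, g (rotateAll c z) = g z) ∧ ∀ z, chainDist l z = x → g z ≠ 0) ∧
      ∀ {α : ℝ → ℝ} {a a' b' b : ℝ}, IsPaused α a a' b' b →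
        (∀ t, α t ∈ Set.range (chainDist l)) → ∀ {z w}, chainDist l z = α a →
        chainDist l w = α b → (∃ t ∈ Set.Icc a b, α t ∈ G) → LiftOn (chainDist l) α a b z w := by
  -- Sorting in the dual order puts the longest edge first.
  obtain ⟨e, he⟩ : ∃ e : Equiv.Perm (Fin (n + 1)), Antitone (l ∘ e) :=
    ⟨Tuple.sort (fun i => OrderDual.toDual (l i)), fun i j hij =>
      Tuple.monotone_sort (fun i => OrderDual.toDual (l i)) hij⟩
  obtain ⟨m, M, G, D⟩ := exists_chainData_of_antitone (l ∘ e) (fun i => hl (e i)) he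
  have hd : ∀ z, chainDist (l ∘ e) (z ∘ e) = chainDist l z := by
    intro z
    unfold chainDist chainVec
    congr 1
    exact Equiv.sum_comp e (fun i => (l i : ℂ) * z i)
  have hee : ∀ z : Fin (n + 1) → Circle, (z ∘ e) ∘ e.symm = z := by
    intro z
    funext i
    simp
  have hee' : ∀ z : Fin (n + 1) → Circle, (z ∘ e.symm) ∘ e = z := by
    intro z
    funext i
    simp
  have hcont : ∀ f : Equiv.Perm (Fin (n + 1)),
      Continuous (fun z : Fin (n + 1) → Circle => z ∘ f) := by
    intro f
    exact continuous_pi fun i => continuous_apply (f i)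
  have hr : ∀ x ∈ Set.range (chainDist l), x ∈ Set.Icc m M := by
    rintro _ ⟨z, rfl⟩
    rw [← hd]
    exact D.range _
  refine ⟨G, ?_, ?_⟩
  · intro x hx hxG
    obtain ⟨g, hg, hinv, hrot, hg0⟩ := D.sep {x} Set.ordConnected_singleton
      (Set.singleton_subset_iff.2 ⟨hr x hx, hxG⟩)
    refine ⟨fun z => g (z ∘ e), hg.comp (hcont e), fun z => hinv (z ∘ e),
      fun c z => hrot c (z ∘ e), fun z hz => hg0 _ ?_⟩
    rw [hd, hz]
    rfl
  · intro α a a' b' b h hα z w hz hw hm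
    have H := D.lift h (fun t => hr _ (hα t)) ((hd z).trans hz) ((hd w).trans hw) hm
    have := H.map (hcont e.symm) (g := chainDist l) (fun v => by rw [← hd, hee'])
    simpa only [hee] using this

/-! ### From chains to configurations of path linkages. -/

theorem Fin.partialSum_last_eq_sum {M : Type*} [AddCommMonoid M] {n : ℕ} (f : Fin n → M) :
    Fin.partialSum f (Fin.last n) = ∑ i, f i := by
  rw [Fin.partialSum, Fin.val_last, List.take_of_length_le (by simp), List.sum_ofFn]

/-- The identification of the complex numbers with the plane. -/
noncomputable def planeOfComplex : ℂ ≃ₗᵢ[ℝ] Plane := Complex.orthonormalBasisOneI.repr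

theorem circleDir_mul (c : Circle) {w : ℂ} (hw : w ≠ 0) :
    circleDir (c * w) = c * circleDir w := by
  ext
  rw [coe_circleDir (mul_ne_zero c.coe_ne_zero hw), Circle.coe_mul, coe_circleDir hw, norm_mul,
    Circle.norm_coe, one_mul, mul_div_assoc]

/-- The linear part of an orientation preserving isometry of the plane is a rotation. -/
theorem exists_rotation_of_mem {g : Plane ≃ᵃⁱ[ℝ] Plane} (hg : g ∈ orientationPreservingIsometries) :
    ∃ c : Circle, ∀ x y : Plane,
      planeOfComplex.symm (g x - g y) = c * planeOfComplex.symm (x - y) := by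
  set A : ℂ ≃ₗᵢ[ℝ] ℂ :=
    (planeOfComplex.trans g.linearIsometryEquiv).trans planeOfComplex.symm with hA
  have hdet : 0 < LinearMap.det (A.toLinearEquiv : ℂ →ₗ[ℝ] ℂ) := by
    have h := LinearMap.det_conj
      (g.linearIsometryEquiv.toLinearEquiv : Plane →ₗ[ℝ] Plane) planeOfComplex.symm.toLinearEquiv
    have h' : 0 < LinearMap.det (g.linearIsometryEquiv.toLinearEquiv : Plane →ₗ[ℝ] Plane) := hg
    rw [← h] at h'
    exact h'
  have hA' : ∀ x y : Plane, planeOfComplex.symm (g x - g y) = A (planeOfComplex.symm (x - y)) := by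
    intro x y
    have : g x - g y = g.linearIsometryEquiv (x - y) := (g.map_vsub x y).symm
    rw [this]
    simp [hA]
  obtain ⟨c, hc | hc⟩ := linear_isometry_complex A
  · refine ⟨c, fun x y => ?_⟩
    rw [hA', hc, rotation_apply]
  -- A rotation composed with conjugation has determinant `-1`.
  · exfalso
    have e : (A.toLinearEquiv : ℂ →ₗ[ℝ] ℂ) = ((rotation c).toLinearEquiv : ℂ →ₗ[ℝ] ℂ) ∘ₗ
        (Complex.conjLIE.toLinearEquiv : ℂ →ₗ[ℝ] ℂ) := by
      rw [hc]
      rfl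
    rw [e, LinearMap.det_comp, det_rotation, Complex.det_conjLIE] at hdet
    norm_num at hdet

namespace Linkage

variable {V : Type*} {P : Linkage V} {k : ℕ} (φ : SimpleGraph.pathGraph (k + 1) ≃g P.graph)

theorem adj_castSucc_succ (i : Fin k) : P.graph.Adj (φ i.castSucc) (φ i.succ) :=
  φ.map_rel_iff.2 (SimpleGraph.pathGraph_adj.2 (Or.inl (by simp)))

/-- The length of the `i`-th edge of a path linkage. -/
noncomputable def edgeLen (i : Fin k) : ℝ :=
  P.len ⟨s(φ i.castSucc, φ i.succ), P.graph.mem_edgeSet.mpr (adj_castSucc_succ φ i)⟩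

variable {φ} in
theorem dist_eq_len_of_edgeLen {q : V → Plane}
    (hq : ∀ i : Fin k, dist (q (φ i.castSucc)) (q (φ i.succ)) = edgeLen φ i) (u v : V)
    (h : P.graph.Adj u v) :
    dist (q u) (q v) = P.len ⟨s(u, v), P.graph.mem_edgeSet.mpr h⟩ := by
  obtain ⟨i, rfl⟩ := φ.surjective u
  obtain ⟨j, rfl⟩ := φ.surjective v
  have hij := SimpleGraph.pathGraph_adj.1 (φ.map_rel_iff.1 h)
  rcases hij with hij | hij
  · obtain ⟨e, rfl⟩ : ∃ e : Fin k, e.castSucc = i := ⟨⟨i, by omega⟩, rfl⟩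
    obtain rfl : e.succ = j := Fin.ext hij
    exact hq e
  · obtain ⟨e, rfl⟩ : ∃ e : Fin k, e.castSucc = j := ⟨⟨j, by omega⟩, rfl⟩
    obtain rfl : e.succ = i := Fin.ext hij
    rw [dist_comm, hq e, edgeLen]
    congr 2
    exact Subtype.ext Sym2.eq_swap

/-- The configuration of a path linkage which starts at the origin and has edge directions `z`. -/
noncomputable def chainConfig (z : Fin k → Circle) : P.Config :=
  ⟨fun v => planeOfComplex (Fin.partialSum (fun i => (edgeLen φ i : ℂ) * z i) (φ.symm v)),
    dist_eq_len_of_edgeLen (φ := φ) (by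
      intro i
      rw [planeOfComplex.dist_map, φ.symm_apply_apply, φ.symm_apply_apply, Fin.partialSum_succ,
        dist_self_add_right, norm_mul, Circle.norm_coe, Complex.norm_real, mul_one]
      exact Real.norm_of_nonneg (NNReal.coe_nonneg _))⟩

theorem continuous_chainConfig : Continuous (chainConfig φ) := by
  refine Continuous.subtype_mk (continuous_pi fun v => planeOfComplex.continuous.comp ?_) _
  refine Fin.induction (motive := fun i => Continuous fun z : Fin k → Circle =>
    Fin.partialSum (fun i => (edgeLen φ i : ℂ) * z i) i) ?_ ?_ (φ.symm v)
  · simpa using continuous_const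
  · intro i hi
    simp only [Fin.partialSum_succ]
    exact hi.add (continuous_const.mul (continuous_coe_circle.comp (continuous_apply i)))

/-- The direction of the `i`-th edge of a configuration of a path linkage. -/
noncomputable def edgeDir (p : P.Config) (i : Fin k) : Circle :=
  circleDir (planeOfComplex.symm (p.1 (φ i.succ) - p.1 (φ i.castSucc)))

theorem norm_edge (p : P.Config) (i : Fin k) :
    ‖planeOfComplex.symm (p.1 (φ i.succ) - p.1 (φ i.castSucc))‖ = edgeLen φ i := by
  rw [planeOfComplex.symm.norm_map, ← dist_eq_norm, dist_comm]
  exact p.2 _ _ (adj_castSucc_succ φ i)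

theorem edgeLen_mul_edgeDir (p : P.Config) (i : Fin k) :
    (edgeLen φ i : ℂ) * edgeDir φ p i =
      planeOfComplex.symm (p.1 (φ i.succ) - p.1 (φ i.castSucc)) := by
  rw [← norm_edge φ p i, edgeDir, norm_mul_circleDir]

theorem edge_ne_zero {φ : SimpleGraph.pathGraph (k + 1) ≃g P.graph} (hl : ∀ i, 0 < edgeLen φ i)
    (p : P.Config) (i : Fin k) :
    planeOfComplex.symm (p.1 (φ i.succ) - p.1 (φ i.castSucc)) ≠ 0 := by
  rw [← norm_pos_iff, norm_edge]
  exact hl i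

theorem continuous_edgeDir {φ : SimpleGraph.pathGraph (k + 1) ≃g P.graph}
    (hl : ∀ i, 0 < edgeLen φ i) : Continuous (edgeDir φ) := by
  refine continuous_pi fun i => ?_
  refine continuousOn_circleDir.comp_continuous ?_ (fun p => edge_ne_zero hl p i)
  have h : ∀ v, Continuous fun p : P.Config => p.1 v := fun v =>
    (continuous_apply v).comp continuous_subtype_val
  exact planeOfComplex.symm.continuous.comp ((h _).sub (h _))

theorem edgeDir_chainConfig {φ : SimpleGraph.pathGraph (k + 1) ≃g P.graph}
    (hl : ∀ i, 0 < edgeLen φ i) (z : Fin k → Circle) : edgeDir φ (chainConfig φ z) = z := by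
  funext i
  simp only [edgeDir, chainConfig, φ.symm_apply_apply, Fin.partialSum_succ, map_add,
    add_sub_cancel_left, planeOfComplex.symm_apply_apply]
  exact circleDir_norm_mul (hl i) (z i)

theorem exists_edgeDir_smul {φ : SimpleGraph.pathGraph (k + 1) ≃g P.graph}
    (hl : ∀ i, 0 < edgeLen φ i) (g : orientationPreservingIsometries) (p : P.Config) :
    ∃ c, edgeDir φ (g • p) = rotateAll c (edgeDir φ p) := by
  obtain ⟨c, hc⟩ := exists_rotation_of_mem g.2
  refine ⟨c, funext fun i => ?_⟩
  change circleDir (planeOfComplex.symm (g.1 (p.1 (φ i.succ)) - g.1 (p.1 (φ i.castSucc)))) = _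
  rw [hc, circleDir_mul c (edge_ne_zero hl p i)]
  rfl

/-- Translating `p` so that its first vertex is at the origin gives exactly the rebuilt chain. -/
theorem mk_chainConfig_edgeDir (p : P.Config) :
    (Quotient.mk _ (chainConfig φ (edgeDir φ p)) : P.Moduli) = Quotient.mk _ p := by
  have key : ∀ i : Fin (k + 1), planeOfComplex
      (Fin.partialSum (fun i => (edgeLen φ i : ℂ) * edgeDir φ p i) i) =
        p.1 (φ i) - p.1 (φ 0) := by
    intro i
    induction i using Fin.induction with
    | zero => simp
    | succ i ih =>
      rw [Fin.partialSum_succ, map_add, ih, edgeLen_mul_edgeDir,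
        planeOfComplex.apply_symm_apply]
      abel
  refine Quotient.sound ⟨⟨AffineIsometryEquiv.constVAdd ℝ Plane (-p.1 (φ 0)), ?_⟩, ?_⟩
  · change 0 < LinearMap.det (LinearMap.id : Plane →ₗ[ℝ] Plane)
    simp
  · refine Subtype.ext (funext fun v => ?_)
    change -p.1 (φ 0) + p.1 v = planeOfComplex _
    rw [key, φ.apply_symm_apply]
    abel

theorem endDist_chainConfig {s t : V} (hs : φ 0 = s) (ht : φ (Fin.last k) = t)
    (z : Fin k → Circle) :
    P.endDist s t (Quotient.mk _ (chainConfig φ z)) = chainDist (edgeLen φ) z := by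
  subst hs ht
  change dist (planeOfComplex _) (planeOfComplex _) = _
  rw [planeOfComplex.dist_map, φ.symm_apply_apply, φ.symm_apply_apply, Fin.partialSum_zero,
    Fin.partialSum_last_eq_sum, dist_zero_left]
  rfl

theorem distSet_eq_range {s t : V} (hs : φ 0 = s) (ht : φ (Fin.last k) = t) :
    P.distSet s t = Set.range (chainDist (edgeLen φ)) := by
  ext x
  constructor
  · rintro ⟨p, rfl⟩
    induction p using Quotient.inductionOn with
    | h p => exact ⟨edgeDir φ p, by rw [← endDist_chainConfig φ hs ht, mk_chainConfig_edgeDir]⟩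
  · rintro ⟨z, rfl⟩
    exact ⟨_, endDist_chainConfig φ hs ht z⟩

/-- A rotation invariant function of the edge directions which is odd under reflection and does not
vanish on a fibre disconnects that fibre. -/
theorem not_mem_nabla {φ : SimpleGraph.pathGraph (k + 1) ≃g P.graph}
    (hl : ∀ i, 0 < edgeLen φ i) {s t : V} (hs : φ 0 = s) (ht : φ (Fin.last k) = t)
    {g : (Fin k → Circle) → ℝ} (hg : Continuous g) (hinv : ∀ z, g z⁻¹ = -g z)
    (hrot : ∀ c z, g (rotateAll c z) = g z) {x : P.distSet s t}
    (hg0 : ∀ z, chainDist (edgeLen φ) z = x → g z ≠ 0) : x ∉ P.nabla s t := by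
  intro hx
  have hwd : ∀ p q : P.Config, (MulAction.orbitRel orientationPreservingIsometries P.Config) p q →
      g (edgeDir φ p) = g (edgeDir φ q) := by
    rintro _ q ⟨a, rfl⟩
    obtain ⟨c, hc⟩ := exists_edgeDir_smul hl a q
    simp only [hc, hrot]
  set F : P.Moduli → ℝ := Quotient.lift (fun p => g (edgeDir φ p)) hwd with hF
  have hFc : Continuous F := (hg.comp (continuous_edgeDir hl)).quotient_lift hwd
  have hFz : ∀ z, F (Quotient.mk _ (chainConfig φ z)) = g z := by
    intro z
    change g (edgeDir φ (chainConfig φ z)) = g z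
    rw [edgeDir_chainConfig hl]
  have hmem : ∀ z, chainDist (edgeLen φ) z = x →
      (Quotient.mk _ (chainConfig φ z) : P.Moduli) ∈ P.theta s t ⁻¹' {x} := fun z hz =>
    Subtype.ext ((endDist_chainConfig φ hs ht z).trans hz)
  -- If the fibre were connected, its image would be an interval containing `g z` and `-g z`, hence
  -- `0`.
  have hconn : (F '' (P.theta s t ⁻¹' {x})).OrdConnected :=
    (hx.isPreconnected.image F hFc.continuousOn).ordConnected
  obtain ⟨z, hz⟩ := (distSet_eq_range φ hs ht).subset x.2
  have h₁ : g z ∈ F '' (P.theta s t ⁻¹' {x}) := ⟨_, hmem z hz, hFz z⟩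
  have h₂ : -g z ∈ F '' (P.theta s t ⁻¹' {x}) :=
    ⟨_, hmem z⁻¹ (by rw [chainDist_inv, hz]), by rw [hFz, hinv]⟩
  have h₀ : (0 : ℝ) ∈ F '' (P.theta s t ⁻¹' {x}) := by
    rcases le_total 0 (g z) with h | h
    · exact hconn.out h₂ h₁ ⟨by linarith, h⟩
    · exact hconn.out h₁ h₂ ⟨h, by linarith⟩
  obtain ⟨p, hp, hp0⟩ := h₀
  induction p using Quotient.inductionOn with
  | h p =>
    refine hg0 (edgeDir φ p) ?_ hp0
    rw [← endDist_chainConfig φ hs ht, mk_chainConfig_edgeDir]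
    exact congrArg Subtype.val hp

end Linkage

/-! ### The theorem. -/

theorem mainTheorem4 {V : Type*} (P : Linkage V) (k : ℕ) (s t : V)
    (hk : 2 ≤ k) (hP : P.IsPathLinkage k s t) (hlen : ∀ e, P.len e ≠ 0)
    (p q : P.Moduli) (α : unitInterval → P.distSet s t) (hα : Continuous α)
    (ε δ : ℝ) (hε : 0 < ε) (hδ : 0 < δ)
    (hαp : ∀ x : unitInterval, (x : ℝ) ∈ Set.Icc 0 ε → α x = P.theta s t p)
    (hαq : ∀ x : unitInterval, (x : ℝ) ∈ Set.Icc (1 - δ) 1 → α x = P.theta s t q)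
    (hmeet : (Set.range α ∩ P.nabla s t).Nonempty) :
    ∃ β : unitInterval → P.Moduli, Continuous β ∧ β 0 = p ∧ β 1 = q ∧
      P.theta s t ∘ β = α := by
  obtain ⟨φ, hs, ht⟩ := hP
  obtain ⟨n, rfl⟩ : ∃ n, k = n + 1 := ⟨k - 1, by omega⟩
  have hl : ∀ i, 0 < Linkage.edgeLen φ i := fun i =>
    NNReal.coe_pos.2 (pos_iff_ne_zero.2 (hlen _))
  obtain ⟨G, hsep, hlift⟩ := exists_chain_lifting (Linkage.edgeLen φ) hl
  induction p using Quotient.inductionOn with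
  | h p =>
  induction q using Quotient.inductionOn with
  | h q =>
  rw [← Linkage.mk_chainConfig_edgeDir φ p] at hαp ⊢
  rw [← Linkage.mk_chainConfig_edgeDir φ q] at hαq ⊢
  -- `α` is extended to the line by its end values.
  set A : ℝ → ℝ := fun x => (α (Set.projIcc 0 1 zero_le_one x) : ℝ) with hA
  have hAc : Continuous A :=
    continuous_subtype_val.comp (hα.comp continuous_projIcc)
  have hAα : ∀ x : unitInterval, A x = α x := fun x => by
    simp only [hA, Set.projIcc_val]
  -- Cutting both pauses at `1 / 2` keeps the first before the second when `ε` or `δ` is large.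
  have hAp : ∀ x ∈ Set.Icc (0 : ℝ) (min ε (1 / 2)),
      A x = chainDist (Linkage.edgeLen φ) (Linkage.edgeDir φ p) := by
    intro x hx
    have hx1 : x ≤ 1 := (hx.2.trans (min_le_right _ _)).trans (by norm_num)
    rw [← Linkage.endDist_chainConfig φ hs ht]
    exact (hAα ⟨x, hx.1, hx1⟩).trans
      (congrArg Subtype.val (hαp ⟨x, hx.1, hx1⟩ ⟨hx.1, hx.2.trans (min_le_left _ _)⟩))
  have hAq : ∀ x ∈ Set.Icc (max (1 - δ) (1 / 2)) (1 : ℝ),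
      A x = chainDist (Linkage.edgeLen φ) (Linkage.edgeDir φ q) := by
    intro x hx
    have hx0 : 0 ≤ x := le_trans (by norm_num) ((le_max_right _ _).trans hx.1)
    rw [← Linkage.endDist_chainConfig φ hs ht]
    exact (hAα ⟨x, hx0, hx.2⟩).trans
      (congrArg Subtype.val (hαq ⟨x, hx0, hx.2⟩ ⟨(le_max_left _ _).trans hx.1, hx.2⟩))
  have hA0 := hAp 0 ⟨le_rfl, by positivity⟩
  have hA1 := hAq 1 ⟨max_le (by linarith) (by norm_num), le_rfl⟩
  have hpaused : IsPaused A 0 (min ε (1 / 2)) (max (1 - δ) (1 / 2)) 1 :=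
    ⟨hAc, by positivity, (min_le_right _ _).trans (le_max_right _ _),
      max_lt (by linarith) (by norm_num), fun x hx => by rw [hAp x hx, hA0],
      fun x hx => by rw [hAq x hx, hA1]⟩
  have hrange : ∀ x, A x ∈ Set.range (chainDist (Linkage.edgeLen φ)) := by
    intro x
    rw [← Linkage.distSet_eq_range φ hs ht]
    exact (α _).2
  have hG : ∃ x ∈ Set.Icc (0 : ℝ) 1, A x ∈ G := by
    obtain ⟨_, ⟨x, rfl⟩, hx⟩ := hmeet
    refine ⟨x, x.2, ?_⟩
    by_contra hcon
    obtain ⟨g, hg, hinv, hrot, hg0⟩ := hsep (A x) (hrange x) hcon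
    rw [hAα] at hg0
    exact Linkage.not_mem_nabla hl hs ht hg hinv hrot hg0 hx
  obtain ⟨γ, hγ, hγ0, hγ1, hγA⟩ := hlift hpaused hrange hA0.symm hA1.symm hG
  refine ⟨fun x => Quotient.mk _ (Linkage.chainConfig φ (γ x)), ?_, ?_, ?_, ?_⟩
  · refine continuous_quotient_mk'.comp ((Linkage.continuous_chainConfig φ).comp ?_)
    exact hγ.comp_continuous continuous_subtype_val fun x => x.2
  · simp only [Set.Icc.coe_zero, hγ0]
  · simp only [Set.Icc.coe_one, hγ1]
  · funext x
    refine Subtype.ext ?_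
    change P.endDist s t (Quotient.mk _ (Linkage.chainConfig φ (γ x))) = α x
    rw [Linkage.endDist_chainConfig φ hs ht, hγA x x.2, hAα]
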